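/- Let $f:\mathbb C\to\mathbb C$ be a transcendental entire function such that the inverse of $f$ has only finitely many singular values and only algebraic singularities (that is, $f$ has finitely many critical values and no finite asymptotic values), all critical points of $f$ are simple ($f''(c)\neq 0$ whenever $f'(c)=0$), and $\sum_i b_i/c_i^3$ converges absolutely, where the $c_i$ are the critical points of $f$ (a critical point at $0$, if any, being omitted from the sum) and $b_i=1/f''(c_i)$. Assume $f(0)=0$, $f(1)=1$. Let $c_1\in J(f)$ be a critical point in the Julia set, put $d_1=f(c_1)$ and $X_{c_1}=\overline{\{f^n(d_1):n\ge 0\}}$, and assume that $c_1$ is summable: $(f^n)'(d_1)\ne0$ for all $n\ge 0$, the series $\sum_{n\ge0} \frac{1}{(f^n)'(d_1)}$ converges absolutely and, if $X_{c_1}$ is unbounded, also $\sum_{n\ge0}\frac{|f^n(d_1)|\,\bigl|\ln|f^n(d_1)|\bigr|}{(f^n)'(d_1)}$ converges absolutely (a term with $f^n(d_1)=0$ being read as $0$). Assume $d_1\notin\{0,1\}$. Let $Y=\mathbb C\setminus X_{c_1}$, let $\gamma_a(z)=\frac{a(a-1)}{z(z-1)(z-a)}$, and let $$\varphi(z)=A(d_1,z)=\sum_{n\ge0}\frac{\gamma_{f^n(d_1)}(z)}{(f^n)'(d_1)}.$$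 Then $\varphi$ does not vanish identically on $Y$, i.e. there is $z\in Y\setminus\{0,1\}$ with $\varphi(z)\neq0$, in each of the following cases (whether $X_{c_1}$ is bounded or not): 1. no preimage of $d_1$ lies in $X_{c_1}$, i.e. $f^{-1}(d_1)\cap X_{c_1}=\emptyset$; 2. $Y\neq\emptyset$ and the (Euclidean) diameters of the connected components of $Y$ are bounded below by a positive constant; 3. $X_{c_1}$ has Lebesgue measure zero; 4. $X_{c_1}\subset\bigcup_i\partial D_i$, where the $D_i$ are the connected components of the Fatou set of $f$. -/

import Mathlib

namespace RuelleEntire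

/-- `f` is a transcendental entire function: entire and not a polynomial. -/
def IsTranscendentalEntire (f : ℂ → ℂ) : Prop :=
  Differentiable ℂ f ∧ ¬ ∃ p : Polynomial ℂ, ∀ z, f z = p.eval z

/-- The critical points of `f`. -/
def critPts (f : ℂ → ℂ) : Set ℂ := {c | deriv f c = 0}

/-- `a` is a (finite) asymptotic value of `f`: the limit of `f` along some path tending to
infinity. -/
def IsAsymptoticValue (f : ℂ → ℂ) (a : ℂ) : Prop :=
  ∃ γ : ℝ → ℂ, ContinuousOn γ (Set.Ici 0) ∧
    Filter.Tendsto γ Filter.atTop (Filter.cocompact ℂ) ∧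
    Filter.Tendsto (fun t => f (γ t)) Filter.atTop (nhds a)

/-- The sequence of functions `F k` tends to infinity, uniformly on the compact subsets of `U`. -/
def TendstoInftyOn (F : ℕ → ℂ → ℂ) (U : Set ℂ) : Prop :=
  ∀ K ⊆ U, IsCompact K → ∀ R : ℝ, ∀ᶠ k in Filter.atTop, ∀ z ∈ K, R < ‖F k z‖

/-- The iterates of `f` form a normal family on `U`: every sequence of iterates has a subsequence
which converges locally uniformly on `U` to a finite function or to infinity. -/
def IteratesNormalOn (f : ℂ → ℂ) (U : Set ℂ) : Prop :=
  ∀ s : ℕ → ℕ, ∃ t : ℕ → ℕ, StrictMono t ∧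
    ((∃ g : ℂ → ℂ, TendstoLocallyUniformlyOn (fun k => f^[s (t k)]) g Filter.atTop U) ∨
      TendstoInftyOn (fun k => f^[s (t k)]) U)

/-- The Fatou set of `f`. -/
def fatouSet (f : ℂ → ℂ) : Set ℂ :=
  {z | ∃ U : Set ℂ, IsOpen U ∧ z ∈ U ∧ IteratesNormalOn f U}

/-- The Julia set of `f`. -/
def juliaSet (f : ℂ → ℂ) : Set ℂ := (fatouSet f)ᶜ

/-- `D` is a connected component of the set `S`. -/
def IsComponentOf (D S : Set ℂ) : Prop := ∃ z ∈ S, D = connectedComponentIn S z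

/-- The closure of the forward orbit `{d, f d, f (f d), …}`. -/
def orbitClosure (f : ℂ → ℂ) (d : ℂ) : Set ℂ :=
  closure (Set.range fun n : ℕ => f^[n] d)

/-- The set `X_c` of a critical point `c`: the closure of the forward orbit of `f c`. -/
def XSet (f : ℂ → ℂ) (c : ℂ) : Set ℂ := orbitClosure f (f c)

/-- The point `a` is summable for `f`. The series of `1 / (fⁿ)'(f a)` has to make sense, so no
derivative `(fⁿ)'(f a)` vanishes. The second series is required only when `X_a` is unbounded. -/
structure IsSummablePoint (f : ℂ → ℂ) (a : ℂ) : Prop where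
  deriv_iterate_ne_zero : ∀ n : ℕ, deriv (f^[n]) (f a) ≠ 0
  summable_inv : Summable fun n : ℕ => 1 / ‖deriv (f^[n]) (f a)‖
  summable_log : ¬ Bornology.IsBounded (XSet f a) →
    Summable fun n : ℕ => ‖f^[n] (f a)‖ * |Real.log ‖f^[n] (f a)‖| / ‖deriv (f^[n]) (f a)‖

/-- The standing assumptions on the maps: `f` is transcendental entire, the inverse function has
only finitely many singular values, all singularities of the inverse being algebraic (that is,
there are no asymptotic values and only finitely many critical values), all critical points are
simple, and `∑ bᵢ / cᵢ³` converges absolutely, where the `cᵢ` are the critical points and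
`bᵢ = 1 / f''(cᵢ)` is the residue of `1 / f'` at `cᵢ`. (A critical point at `0` contributes
nothing to this series.) -/
structure IsAdmissible (f : ℂ → ℂ) : Prop where
  transcendental : IsTranscendentalEntire f
  finite_critVals : (f '' critPts f).Finite
  no_asymptoticValue : ∀ a : ℂ, ¬ IsAsymptoticValue f a
  simple_crit : ∀ c ∈ critPts f, deriv (deriv f) c ≠ 0
  summable_residues : Summable fun c : critPts f => ‖(1 / deriv (deriv f) c) / (c : ℂ) ^ 3‖

/-- `f` is an admissible map fixing `0` and `1`, with a summable critical point `c` in the Julia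
set. -/
structure HasSummableCritPt (f : ℂ → ℂ) (c : ℂ) : Prop where
  admissible : IsAdmissible f
  map_zero : f 0 = 0
  map_one : f 1 = 1
  isCrit : c ∈ critPts f
  mem_julia : c ∈ juliaSet f
  summable : IsSummablePoint f c

/-- `γ_a(z) = a (a - 1) / (z (z - 1) (z - a))`. -/
noncomputable def gam (a z : ℂ) : ℂ := a * (a - 1) / (z * (z - 1) * (z - a))

/-- `A(d, z) = ∑ₙ γ_{fⁿ(d)}(z) / (fⁿ)'(d)`. -/
noncomputable def ruelleA (f : ℂ → ℂ) (d z : ℂ) : ℂ :=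
  ∑' n : ℕ, gam (f^[n] d) z / deriv (f^[n]) d

/-- The diameters of the components of `Y` are bounded below by a positive constant (unbounded
components have infinite diameter). -/
def ComponentsDiamBoundedBelow (Y : Set ℂ) : Prop :=
  ∃ δ : ℝ, 0 < δ ∧ ∀ D : Set ℂ, IsComponentOf D Y → ENNReal.ofReal δ ≤ Metric.ediam D

end RuelleEntire

section

open MeasureTheory Set Filter Topology Complex

namespace RuelleEntire

/-! Write d = d₁, aₙ = fⁿ(d), lₙ = 1/(fⁿ)'(d), X = X_{c₁}. As a distribution, ∂̄φ is π times the
measure μ = Σ lₙ δ_{aₙ}, up to masses at 0 and 1. Hence ∫ φ ∂̄h = -π Σ lₙ h(aₙ) for test functions h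
vanishing at 0 and 1 (`ruelleA_pairing`); summability makes φ integrable because the L¹ norm of γ_a
is O(1 + |a| |log|a||). Moreover μ gives d a nonzero mass, whether or not d is periodic
(`mass_ne_zero`). If φ vanishes on Y, only the values of ∂̄h on X enter the pairing, and suitable h
give a contradiction.

X null: φ = 0 almost everywhere, and bumps shrinking to d recover the mass at d.

Large components, or X in the union of Fatou boundaries: connected open subsets of Y of definite
size come arbitrarily close to d. A slit of size ε in such a set carries a bounded function,
holomorphic off the slit, equal to 1 at d and O(ε) at a fixed distance (`exists_peak`). Cut off, it
has small ∂̄ on X, yet its pairing with μ tends to the mass at d (`false_of_long_zero_sets`).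

No preimage of d in X: for w in Y near d, compare the kernel χ(u)/(u - w) with its pull-back as a
vector field, χ(f(z))/((f(z) - w) f'(z)). By the chain rule the second sum against μ is the first
without its term n = 0. Both have ∂̄ bounded on X uniformly in w, so the missing term 1/(d - w)
stays bounded as w tends to d, which is absurd. The poles of the pull-back lie over w and d, hence
off X. Its support need not be compact, but without asymptotic values it is exhausted by compact
pieces (`exists_clopen_piece`).

That Y accumulates at d, used in the first and second cases, comes from
`notMem_interior_orbitClosure`: otherwise f maps a neighbourhood of c₁ into the forward invariant
set X, the iterates there omit a disc, and c₁ would be in the Fatou set. -/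

/-! ### The operator ∂̄ and the Cauchy–Pompeiu formula. -/

/-- The Wirtinger derivative `∂h/∂z̄`. -/
noncomputable def dbar (h : ℂ → ℂ) (z : ℂ) : ℂ :=
  (fderiv ℝ h z 1 + I * fderiv ℝ h z I) / 2

theorem continuous_dbar {h : ℂ → ℂ} (hh : ContDiff ℝ 1 h) : Continuous (dbar h) := by
  have h1 := hh.continuous_fderiv one_ne_zero
  unfold dbar
  fun_prop

theorem dbar_eq_zero_of_notMem_tsupport {h : ℂ → ℂ} {z : ℂ} (hz : z ∉ tsupport h) :
    dbar h z = 0 := by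
  have : fderiv ℝ h z = 0 := by
    have := (tsupport_fderiv_subset ℝ (f := h))
    exact image_eq_zero_of_notMem_tsupport fun h' => hz (this h')
  simp [dbar, this]

theorem fderiv_real_apply (L : ℂ →L[ℝ] ℂ) (w : ℂ) : L w = w.re * L 1 + w.im * L I := by
  have : w = (w.re : ℝ) • (1 : ℂ) + (w.im : ℝ) • I := by
    simp
  conv_lhs => rw [this]
  rw [map_add, map_smul, map_smul]
  simp

/-- This is ∂̄ in polar form: e^{-it} ∂̄ = (∂_r + (i/r) ∂_t)/2, the two directions being radial and
tangential. -/
theorem exp_mul_dbar (h : ℂ → ℂ) (z : ℂ) (t : ℝ) :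
    exp (-(t * I)) * dbar h z =
      (fderiv ℝ h z (exp (t * I)) + I * fderiv ℝ h z (I * exp (t * I))) / 2 := by
  rw [fderiv_real_apply _ (exp (t * I)), fderiv_real_apply _ (I * exp (t * I)), dbar]
  have e1 : exp (t * I) = Real.cos t + Real.sin t * I := by
    rw [exp_mul_I]; simp
  have e2 : exp (-(t * I)) = Real.cos t - Real.sin t * I := by
    rw [← neg_mul, exp_mul_I]; simp; ring
  have r1 : (exp (t * I)).re = Real.cos t := by simp [e1, -ofReal_cos, -ofReal_sin]
  have r2 : (exp (t * I)).im = Real.sin t := by simp [e1, -ofReal_cos, -ofReal_sin]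
  rw [e2]
  simp only [mul_re, mul_im, I_re, I_im, r1, r2]
  simp only [zero_mul, one_mul, zero_sub, zero_add, ofReal_neg]
  linear_combination -(Real.sin t : ℂ) / 2 * (fderiv ℝ h z I) * I_mul_I

theorem hasFDerivAt_polar {h : ℂ → ℂ} (hh : ContDiff ℝ 1 h) (a : ℂ) (r t : ℝ) :
    HasDerivAt (fun r : ℝ => h (a + r * exp (t * I)))
      (fderiv ℝ h (a + r * exp (t * I)) (exp (t * I))) r ∧
    HasDerivAt (fun t : ℝ => h (a + r * exp (t * I)))
      (r * fderiv ℝ h (a + r * exp (t * I)) (I * exp (t * I))) t := by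
  have hd := (hh.differentiable one_ne_zero (a + r * exp (t * I))).hasFDerivAt
  constructor
  · refine hd.comp_hasDerivAt r ?_
    have := ((hasDerivAt_id r).ofReal_comp.mul_const (exp (t * I))).const_add a
    simpa using this
  · have h2 : HasDerivAt (fun t : ℝ => a + r * exp (t * I)) (r * (I * exp (t * I))) t := by
      have h3 : HasDerivAt (fun t : ℝ => (t : ℂ) * I) (1 * I) t :=
        (hasDerivAt_id t).ofReal_comp.mul_const I
      have h4 := (h3.cexp.const_mul (r : ℂ)).const_add a
      rwa [one_mul, mul_comm (exp _)] at h4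
    have h4 := hd.comp_hasDerivAt t h2
    have : (r : ℂ) * (I * exp (t * I)) = r • (I * exp (t * I)) := by simp
    rw [this, map_smul, real_smul] at h4
    exact h4

/-- In polar coordinates at a the Jacobian r cancels the pole. The tangential part integrates to 0
over each circle by periodicity, the radial part to -h(a) along each ray. -/
theorem integral_dbar_div_self {h : ℂ → ℂ} (hh : ContDiff ℝ 1 h) (hc : HasCompactSupport h)
    (a : ℂ) : ∫ z, dbar h z / (z - a) = -Real.pi * h a := by
  have hDc : Continuous (fderiv ℝ h) := hh.continuous_fderiv one_ne_zero
  obtain ⟨R, hR0, hR⟩ : ∃ R > 0, ∀ z, R ≤ ‖z - a‖ → h z = 0 ∧ fderiv ℝ h z = 0 := by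
    obtain ⟨R, hR⟩ := hc.isCompact.isBounded.subset_ball a
    refine ⟨max R 1, by positivity, fun z hz => ?_⟩
    have hz' : z ∉ tsupport h := fun h' => by
      have := hR h'
      rw [Metric.mem_ball, dist_eq_norm] at this
      exact absurd (lt_of_lt_of_le this (le_max_left _ _)) (not_lt.2 hz)
    refine ⟨image_eq_zero_of_notMem_tsupport hz', image_eq_zero_of_notMem_tsupport fun h' =>
      hz' (tsupport_fderiv_subset ℝ h')⟩
  have key : ∀ r t : ℝ, 0 ≤ r → R ≤ r → h (a + r * exp (t * I)) = 0 ∧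
      fderiv ℝ h (a + r * exp (t * I)) = 0 := fun r t h0 h1 => hR _ (by
    simp [norm_exp_ofReal_mul_I, abs_of_nonneg h0, h1])
  set Dr : ℝ × ℝ → ℂ := fun p => fderiv ℝ h (a + p.1 * exp (p.2 * I)) (exp (p.2 * I)) with hDr
  set Dt : ℝ × ℝ → ℂ := fun p => fderiv ℝ h (a + p.1 * exp (p.2 * I)) (I * exp (p.2 * I)) with hDt
  have cDr : Continuous Dr := by fun_prop
  have cDt : Continuous Dt := by fun_prop
  have hint : ∀ F : ℝ × ℝ → ℂ, Continuous F → (∀ p : ℝ × ℝ, R ≤ p.1 → F p = 0) →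
      IntegrableOn F (Ioi 0 ×ˢ Ioo (-Real.pi) Real.pi) (volume.prod volume) := by
    intro F cF hF
    have h1 : IntegrableOn F (Icc 0 R ×ˢ Icc (-Real.pi) Real.pi) (volume.prod volume) :=
      cF.continuousOn.integrableOn_compact (isCompact_Icc.prod isCompact_Icc)
    have h2 : IntegrableOn F (Ioi R ×ˢ Icc (-Real.pi) Real.pi) (volume.prod volume) := by
      refine (integrableOn_zero (ε' := ℂ)).congr_fun (fun p hp => ?_)
        (measurableSet_Ioi.prod measurableSet_Icc)
      exact (hF p (le_of_lt hp.1)).symm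
    refine (h1.union h2).mono_set ?_
    rintro ⟨r, t⟩ ⟨hr, ht⟩
    rcases le_or_gt r R with h' | h'
    · exact Or.inl ⟨⟨le_of_lt hr, h'⟩, Ioo_subset_Icc_self ht⟩
    · exact Or.inr ⟨h', Ioo_subset_Icc_self ht⟩
  have iDr := hint Dr cDr fun p hp => by
    simp [hDr, (key p.1 p.2 (hR0.le.trans hp) hp).2]
  have iDt := hint Dt cDt fun p hp => by
    simp [hDt, (key p.1 p.2 (hR0.le.trans hp) hp).2]
  have e1 : ∫ z, dbar h z / (z - a) = ∫ z, dbar h (a + z) / z := by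
    rw [← integral_add_left_eq_self _ a]; simp
  rw [e1, ← Complex.integral_comp_polarCoord_symm]
  have e2 : ∫ p in polarCoord.target, p.1 • (dbar h (a + Complex.polarCoord.symm p) /
      Complex.polarCoord.symm p) = ∫ p in Ioi 0 ×ˢ Ioo (-Real.pi) Real.pi,
        (Dr p / 2 + I / 2 * Dt p) := by
    refine setIntegral_congr_fun (measurableSet_Ioi.prod measurableSet_Ioo) ?_
    rintro ⟨r, t⟩ ⟨hr, ht⟩
    have hr' : (r : ℂ) ≠ 0 := ofReal_ne_zero.2 (ne_of_gt hr)
    have e : Complex.polarCoord.symm (r, t) = r * exp (t * I) := by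
      rw [Complex.polarCoord_symm_apply, exp_mul_I]; simp
    simp only [e]
    have := exp_mul_dbar h (a + r * exp (t * I)) t
    rw [exp_neg] at this
    have hne := exp_ne_zero (t * I)
    rw [real_smul]
    calc (r : ℂ) * (dbar h (a + r * exp (t * I)) / (r * exp (t * I)))
        = (exp (t * I))⁻¹ * dbar h (a + r * exp (t * I)) := by field_simp
      _ = _ := by rw [this]; simp only [hDr, hDt]; ring
  have hvol : (volume : Measure (ℝ × ℝ)) = volume.prod volume := rfl
  rw [e2, hvol, integral_add (iDr.div_const 2) (iDt.const_mul (I / 2)), integral_div,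
    integral_const_mul]
  have i1 : ∫ p in Ioi 0 ×ˢ Ioo (-Real.pi) Real.pi, Dr p ∂(volume.prod volume)
      = -(2 * Real.pi) * h a := by
    rw [← setIntegral_prod_swap, setIntegral_prod]
    · have : ∀ t ∈ Ioo (-Real.pi) Real.pi, ∫ r in Ioi (0 : ℝ), Dr (r, t) = -h a := by
        intro t _
        have hi : IntegrableOn (fun r => Dr (r, t)) (Ioi (0 : ℝ)) := by
          have h1 : IntegrableOn (fun r => Dr (r, t)) (Icc (0 : ℝ) R) :=
            (show Continuous fun r => Dr (r, t) by fun_prop).continuousOn.integrableOn_compact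
              isCompact_Icc
          have h2 : IntegrableOn (fun r => Dr (r, t)) (Ioi R) :=
            (integrableOn_zero (ε' := ℂ)).congr_fun
              (fun r hr => by simp [hDr, (key r t (hR0.le.trans (le_of_lt hr)) (le_of_lt hr)).2])
              measurableSet_Ioi
          refine (h1.union h2).mono_set fun r hr => ?_
          rcases le_or_gt r R with h' | h'
          · exact Or.inl ⟨le_of_lt hr, h'⟩
          · exact Or.inr h'
        have := integral_Ioi_of_hasDerivAt_of_tendsto' (a := 0)
          (fun r _ => (hasFDerivAt_polar hh a r t).1) hi (m := 0)
          (tendsto_const_nhds.congr' (by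
            filter_upwards [eventually_ge_atTop R] with r hr
            exact ((key r t (hR0.le.trans hr) hr).1).symm))
        simpa using this
      simp only [Prod.swap_prod_mk]
      rw [setIntegral_congr_fun measurableSet_Ioo this]
      simp [Real.pi_pos.le]
      left; ring
    · exact iDr.swap
  have i2 : ∫ p in Ioi 0 ×ˢ Ioo (-Real.pi) Real.pi, Dt p ∂(volume.prod volume) = 0 := by
    rw [setIntegral_prod _ iDt]
    refine setIntegral_eq_zero_of_forall_eq_zero fun r hr => ?_
    have hr' : (r : ℂ) ≠ 0 := ofReal_ne_zero.2 (ne_of_gt hr)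
    rw [← integral_Ioc_eq_integral_Ioo, ← intervalIntegral.integral_of_le (by linarith [Real.pi_pos])]
    have h1 := intervalIntegral.integral_eq_sub_of_hasDerivAt (a := -Real.pi) (b := Real.pi)
      (fun t _ => (hasFDerivAt_polar hh a r t).2)
      (Continuous.intervalIntegrable (by fun_prop) _ _)
    rw [intervalIntegral.integral_const_mul] at h1
    have h2 : exp ((Real.pi : ℝ) * I) = exp (((-Real.pi : ℝ) : ℂ) * I) := by
      rw [ofReal_neg, neg_mul, exp_neg, exp_pi_mul_I]; norm_num
    rw [h2, sub_self] at h1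
    exact (mul_eq_zero.1 h1).resolve_left hr'
  rw [i1, i2]; ring

/-! ### L¹ bounds for the kernels γ_a. -/

theorem radial_integral {F : ℝ → ℝ} (hF : IntegrableOn (fun r => r * F r) (Ioi 0)) (p : ℂ) :
    Integrable (fun z : ℂ => F ‖z - p‖) ∧
      ∫ z : ℂ, F ‖z - p‖ = 2 * Real.pi * ∫ r in Ioi (0 : ℝ), r * F r := by
  have hd : Module.finrank ℝ ℂ = 2 := Complex.finrank_real_complex
  constructor
  · have : Integrable (fun z : ℂ => F ‖z‖) := by
      rw [integrable_fun_norm_addHaar (μ := (volume : Measure ℂ))]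
      simpa [hd] using hF
    exact this.comp_sub_right p
  · rw [integral_sub_right_eq_self (fun z : ℂ => F ‖z‖) p,
      integral_fun_norm_addHaar (volume : Measure ℂ)]
    simp [hd, Measure.real]
    ring

theorem radial_integral_indicator {S : Set ℝ} (hS : MeasurableSet S) (hS0 : S ⊆ Ioi 0)
    {g : ℝ → ℝ} (hg : IntegrableOn (fun r => r * g r) S) (p : ℂ) :
    Integrable (fun z : ℂ => S.indicator g ‖z - p‖) ∧
      ∫ z : ℂ, S.indicator g ‖z - p‖ = 2 * Real.pi * ∫ r in S, r * g r := by
  have e : (fun r => r * S.indicator g r) = S.indicator fun r => r * g r := by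
    ext r
    by_cases h : r ∈ S <;> simp [h]
  have i1 : IntegrableOn (fun r => r * S.indicator g r) (Ioi 0) := by
    rw [e]
    exact ((integrable_indicator_iff hS).2 hg).integrableOn
  have := radial_integral i1 p
  refine ⟨this.1, this.2.trans ?_⟩
  rw [e, setIntegral_indicator hS, inter_eq_right.2 hS0]

theorem radial_inv {R : ℝ} (hR : 0 ≤ R) (p : ℂ) :
    Integrable (fun z : ℂ => (Ioc 0 R).indicator (fun r : ℝ => r⁻¹) ‖z - p‖) ∧
      ∫ z : ℂ, (Ioc 0 R).indicator (fun r : ℝ => r⁻¹) ‖z - p‖ = 2 * Real.pi * R := by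
  have e : EqOn (fun r : ℝ => r * r⁻¹) (fun _ => 1) (Ioc 0 R) := fun r hr =>
    mul_inv_cancel₀ (ne_of_gt hr.1)
  have i1 : IntegrableOn (fun _ : ℝ => (1 : ℝ)) (Ioc 0 R) := integrableOn_const (by simp)
  have := radial_integral_indicator measurableSet_Ioc (fun x hx => hx.1)
    (i1.congr_fun e.symm measurableSet_Ioc) p
  refine ⟨this.1, this.2.trans ?_⟩
  rw [setIntegral_congr_fun measurableSet_Ioc e]
  simp [hR]

theorem radial_inv_sq {s t : ℝ} (hs : 0 < s) (hst : s ≤ t) (p : ℂ) :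
    Integrable (fun z : ℂ => (Ioc s t).indicator (fun r : ℝ => (r ^ 2)⁻¹) ‖z - p‖) ∧
      ∫ z : ℂ, (Ioc s t).indicator (fun r : ℝ => (r ^ 2)⁻¹) ‖z - p‖ =
        2 * Real.pi * Real.log (t / s) := by
  have e : EqOn (fun r : ℝ => r * (r ^ 2)⁻¹) (fun r => r⁻¹) (Ioc s t) := fun r hr => by
    have : r ≠ 0 := ne_of_gt (hs.trans hr.1)
    simp only; field_simp
  have hc : ContinuousOn (fun r : ℝ => r⁻¹) (Icc s t) :=
    continuousOn_inv₀.mono fun x hx => ne_of_gt (hs.trans_le hx.1)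
  have i1 : IntegrableOn (fun r : ℝ => r⁻¹) (Ioc s t) :=
    (hc.integrableOn_compact isCompact_Icc).mono_set Ioc_subset_Icc_self
  have := radial_integral_indicator measurableSet_Ioc (fun x hx => hs.trans hx.1)
    (i1.congr_fun e.symm measurableSet_Ioc) p
  refine ⟨this.1, this.2.trans ?_⟩
  rw [setIntegral_congr_fun measurableSet_Ioc e, ← intervalIntegral.integral_of_le hst,
    integral_inv_of_pos hs (hs.trans_le hst)]

theorem radial_inv_cube {R : ℝ} (hR : 0 < R) (p : ℂ) :
    Integrable (fun z : ℂ => (Ioi R).indicator (fun r : ℝ => (r ^ 3)⁻¹) ‖z - p‖) ∧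
      ∫ z : ℂ, (Ioi R).indicator (fun r : ℝ => (r ^ 3)⁻¹) ‖z - p‖ = 2 * Real.pi * R⁻¹ := by
  have e : EqOn (fun r : ℝ => r * (r ^ 3)⁻¹) (fun r => r ^ (-2 : ℝ)) (Ioi R) := fun r hr => by
    have h0 : 0 < r := hR.trans hr
    have : r ^ (-2 : ℝ) = (r ^ 2)⁻¹ := by
      rw [Real.rpow_neg h0.le]; norm_cast
    simp only [this]; field_simp
  have i1 := integrableOn_Ioi_rpow_of_lt (a := -2) (by norm_num) hR
  have := radial_integral_indicator measurableSet_Ioi (fun x hx => hR.trans hx)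
    (i1.congr_fun e.symm measurableSet_Ioi) p
  refine ⟨this.1, this.2.trans ?_⟩
  rw [setIntegral_congr_fun measurableSet_Ioi e, integral_Ioi_rpow_of_lt (by norm_num) hR]
  norm_num
  rw [Real.rpow_neg_one]

theorem measurable_gam (a : ℂ) : Measurable (gam a) := by
  unfold gam; fun_prop

theorem gam_partial_fractions {a z : ℂ} (h0 : z ≠ 0) (h1 : z ≠ 1) (ha : z ≠ a) :
    gam a z = (a - 1) / z - a / (z - 1) + 1 / (z - a) := by
  have h1' := sub_ne_zero.2 h1
  have ha' := sub_ne_zero.2 ha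
  unfold gam; field_simp; ring

theorem gam_eq_zero_of_eq {a z : ℂ} (h : z = 0 ∨ z = 1 ∨ z = a) : gam a z = 0 := by
  rcases h with rfl | rfl | rfl <;> simp [gam]

/-- Partial fractions control the three simple poles for |z| ≤ 10; beyond that, the kernel decays
like |z|⁻³. -/
theorem norm_gam_le_of_norm_le {a : ℂ} (ha : ‖a‖ ≤ 4) (z : ℂ) :
    ‖gam a z‖ ≤ 5 * (Ioc 0 10).indicator (fun r : ℝ => r⁻¹) ‖z - 0‖
      + 4 * (Ioc 0 11).indicator (fun r : ℝ => r⁻¹) ‖z - 1‖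
      + 1 * (Ioc 0 14).indicator (fun r : ℝ => r⁻¹) ‖z - a‖
      + 80 * (Ioi 10).indicator (fun r : ℝ => (r ^ 3)⁻¹) ‖z - 0‖ := by
  have nn : ∀ (S : Set ℝ) (g : ℝ → ℝ) (_ : ∀ r, 0 ≤ r → 0 ≤ g r) (w : ℂ),
      0 ≤ S.indicator g ‖w‖ := fun S g hg w =>
    indicator_apply_nonneg fun _ => hg _ (norm_nonneg w)
  have n1 := nn (Ioc 0 10) (fun r => r⁻¹) (fun r hr => by positivity) (z - 0)
  have n2 := nn (Ioc 0 11) (fun r => r⁻¹) (fun r hr => by positivity) (z - 1)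
  have n3 := nn (Ioc 0 14) (fun r => r⁻¹) (fun r hr => by positivity) (z - a)
  have n4 := nn (Ioi 10) (fun r => (r ^ 3)⁻¹) (fun r hr => by positivity) (z - 0)
  have ha1 : ‖a - 1‖ ≤ 5 := (norm_sub_le _ _).trans (by simp; linarith)
  by_cases h : z = 0 ∨ z = 1 ∨ z = a
  · rw [gam_eq_zero_of_eq h, norm_zero]; positivity
  push Not at h
  obtain ⟨h0, h1, h2⟩ := h
  have p0 := norm_pos_iff.2 h0
  have p1 := norm_pos_iff.2 (sub_ne_zero.2 h1)
  have p2 := norm_pos_iff.2 (sub_ne_zero.2 h2)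
  have b1 : ‖z - 1‖ ≤ ‖z‖ + 1 := (norm_sub_le _ _).trans (by simp)
  have b2 : ‖z - a‖ ≤ ‖z‖ + 4 := (norm_sub_le _ _).trans (by linarith)
  have b3 : ‖z‖ - 1 ≤ ‖z - 1‖ := le_trans (by simp) (norm_sub_norm_le z 1)
  have b4 : ‖z‖ - 4 ≤ ‖z - a‖ := le_trans (by linarith) (norm_sub_norm_le z a)
  rcases le_or_gt ‖z‖ 10 with hz | hz
  · rw [indicator_of_mem (show ‖z - 0‖ ∈ Ioc (0 : ℝ) 10 by simp [p0, hz]),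
      indicator_of_mem (show ‖z - 1‖ ∈ Ioc (0 : ℝ) 11 from ⟨p1, by linarith⟩),
      indicator_of_mem (show ‖z - a‖ ∈ Ioc (0 : ℝ) 14 from ⟨p2, by linarith⟩),
      gam_partial_fractions h0 h1 h2]
    have t1 : ‖(a - 1) / z‖ ≤ 5 * ‖z - 0‖⁻¹ := by
      rw [norm_div, sub_zero, div_eq_mul_inv]; gcongr
    have t2 : ‖a / (z - 1)‖ ≤ 4 * ‖z - 1‖⁻¹ := by
      rw [norm_div, div_eq_mul_inv]; gcongr
    have t3 : ‖1 / (z - a)‖ ≤ 1 * ‖z - a‖⁻¹ := by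
      rw [norm_div, div_eq_mul_inv]; simp
    have := norm_add_le ((a - 1) / z - a / (z - 1)) (1 / (z - a))
    have := norm_sub_le ((a - 1) / z) (a / (z - 1))
    linarith
  · rw [indicator_of_mem (show ‖z - 0‖ ∈ Ioi (10 : ℝ) by simpa using hz)]
    have : ‖gam a z‖ ≤ 80 * (‖z - 0‖ ^ 3)⁻¹ := by
      unfold gam
      rw [norm_div, norm_mul, norm_mul, norm_mul, sub_zero, ← div_eq_mul_inv]
      calc ‖a‖ * ‖a - 1‖ / (‖z‖ * ‖z - 1‖ * ‖z - a‖)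
          ≤ 4 * 5 / (‖z‖ * (‖z‖ / 2) * (‖z‖ / 2)) := by gcongr <;> linarith
        _ = _ := by field_simp; norm_num
    linarith

/-- Four zones of |z|, cut at 2, |a|/2 and 2|a|. In the second the kernel is of size |a|/|z|², whose
integral is responsible for the growth |a| log|a|; the other zones contribute O(|a|). -/
theorem norm_gam_le_of_lt_norm {a : ℂ} (ha : 4 < ‖a‖) (z : ℂ) :
    ‖gam a z‖ ≤ 4 * ‖a‖ * (Ioc 0 3).indicator (fun r : ℝ => r⁻¹) ‖z - 0‖
      + 4 * ‖a‖ * (Ioc 0 3).indicator (fun r : ℝ => r⁻¹) ‖z - 1‖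
      + 8 * ‖a‖ * (Ioc 2 ‖a‖).indicator (fun r : ℝ => (r ^ 2)⁻¹) ‖z - 0‖
      + 16 * (Ioc 0 (3 * ‖a‖)).indicator (fun r : ℝ => r⁻¹) ‖z - a‖
      + 8 * ‖a‖ ^ 2 * (Ioi (2 * ‖a‖)).indicator (fun r : ℝ => (r ^ 3)⁻¹) ‖z - 0‖ := by
  have nn : ∀ (S : Set ℝ) (g : ℝ → ℝ) (_ : ∀ r, 0 ≤ r → 0 ≤ g r) (w : ℂ) (C : ℝ), 0 ≤ C → 
      0 ≤ C * S.indicator g ‖w‖ := fun S g hg w C hC =>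
    mul_nonneg hC (indicator_apply_nonneg fun _ => hg _ (norm_nonneg w))
  have n1 := nn (Ioc 0 3) (fun r => r⁻¹) (fun r hr => by positivity) (z - 0) (4 * ‖a‖)
    (by positivity)
  have n2 := nn (Ioc 0 3) (fun r => r⁻¹) (fun r hr => by positivity) (z - 1) (4 * ‖a‖)
    (by positivity)
  have n3 := nn (Ioc 2 ‖a‖) (fun r => (r ^ 2)⁻¹) (fun r hr => by positivity) (z - 0) (8 * ‖a‖)
    (by positivity)
  have n4 := nn (Ioc 0 (3 * ‖a‖)) (fun r => r⁻¹) (fun r hr => by positivity) (z - a) 16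
    (by positivity)
  have n5 := nn (Ioi (2 * ‖a‖)) (fun r => (r ^ 3)⁻¹) (fun r hr => by positivity) (z - 0)
    (8 * ‖a‖ ^ 2) (by positivity)
  have ha1 : ‖a - 1‖ ≤ 2 * ‖a‖ := (norm_sub_le _ _).trans (by simp; linarith)
  have pa : 0 < ‖a‖ := by linarith
  by_cases h : z = 0 ∨ z = 1 ∨ z = a
  · rw [gam_eq_zero_of_eq h, norm_zero]; positivity
  push Not at h
  obtain ⟨h0, h1, h2⟩ := h
  have p0 := norm_pos_iff.2 h0
  have p1 := norm_pos_iff.2 (sub_ne_zero.2 h1)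
  have p2 := norm_pos_iff.2 (sub_ne_zero.2 h2)
  have b1 : ‖z - 1‖ ≤ ‖z‖ + 1 := (norm_sub_le _ _).trans (by simp)
  have b2 : ‖z - a‖ ≤ ‖z‖ + ‖a‖ := norm_sub_le _ _
  have b3 : ‖z‖ - 1 ≤ ‖z - 1‖ := le_trans (by simp) (norm_sub_norm_le z 1)
  have b4 : ‖z‖ - ‖a‖ ≤ ‖z - a‖ := norm_sub_norm_le z a
  have b5 : ‖a‖ - ‖z‖ ≤ ‖z - a‖ := by rw [norm_sub_rev]; exact norm_sub_norm_le a z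
  have e : ‖gam a z‖ = ‖a‖ * ‖a - 1‖ / (‖z‖ * ‖z - 1‖ * ‖z - a‖) := by
    unfold gam
    rw [norm_div, norm_mul, norm_mul, norm_mul]
  rcases le_or_gt ‖z‖ 2 with hz | hz
  · rw [indicator_of_mem (show ‖z - 0‖ ∈ Ioc (0 : ℝ) 3 by simp [p0]; linarith)] at n1 ⊢
    rw [indicator_of_mem (show ‖z - 1‖ ∈ Ioc (0 : ℝ) 3 from ⟨p1, by linarith⟩)] at n2 ⊢
    -- The partial fractions of 1/(z(z - 1)) separate the poles at 0 and 1.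
    have k1 : ‖z‖⁻¹ * ‖z - 1‖⁻¹ ≤ ‖z‖⁻¹ + ‖z - 1‖⁻¹ := by
      have : z⁻¹ * (z - 1)⁻¹ = (z - 1)⁻¹ - z⁻¹ := by
        have := sub_ne_zero.2 h1
        field_simp; ring
      calc ‖z‖⁻¹ * ‖z - 1‖⁻¹ = ‖(z - 1)⁻¹ - z⁻¹‖ := by rw [← this]; simp
        _ ≤ _ := (norm_sub_le _ _).trans (by simp [add_comm])
    have : ‖gam a z‖ ≤ 4 * ‖a‖ * (‖z - 0‖⁻¹ + ‖z - 1‖⁻¹) := by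
      rw [e, sub_zero]
      calc ‖a‖ * ‖a - 1‖ / (‖z‖ * ‖z - 1‖ * ‖z - a‖)
          ≤ ‖a‖ * (2 * ‖a‖) / (‖z‖ * ‖z - 1‖ * (‖a‖ / 2)) := by gcongr; linarith
        _ = 4 * ‖a‖ * (‖z‖⁻¹ * ‖z - 1‖⁻¹) := by field_simp; norm_num
        _ ≤ _ := by gcongr
    linarith
  rcases le_or_gt ‖z‖ (‖a‖ / 2) with hz2 | hz2
  · rw [indicator_of_mem (show ‖z - 0‖ ∈ Ioc (2 : ℝ) ‖a‖ by simp [hz]; linarith)] at n3 ⊢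
    have : ‖gam a z‖ ≤ 8 * ‖a‖ * (‖z - 0‖ ^ 2)⁻¹ := by
      rw [e, sub_zero]
      calc ‖a‖ * ‖a - 1‖ / (‖z‖ * ‖z - 1‖ * ‖z - a‖)
          ≤ ‖a‖ * (2 * ‖a‖) / (‖z‖ * (‖z‖ / 2) * (‖a‖ / 2)) := by gcongr <;> linarith
        _ = _ := by field_simp; norm_num
    linarith
  rcases le_or_gt ‖z‖ (2 * ‖a‖) with hz3 | hz3
  · rw [indicator_of_mem (show ‖z - a‖ ∈ Ioc (0 : ℝ) (3 * ‖a‖) from ⟨p2, by linarith⟩)] at n4 ⊢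
    have : ‖gam a z‖ ≤ 16 * ‖z - a‖⁻¹ := by
      rw [e]
      calc ‖a‖ * ‖a - 1‖ / (‖z‖ * ‖z - 1‖ * ‖z - a‖)
          ≤ ‖a‖ * (2 * ‖a‖) / ((‖a‖ / 2) * (‖a‖ / 4) * ‖z - a‖) := by gcongr; linarith
        _ = _ := by field_simp; norm_num
    linarith
  · rw [indicator_of_mem (show ‖z - 0‖ ∈ Ioi (2 * ‖a‖) by simpa using hz3)] at n5 ⊢
    have : ‖gam a z‖ ≤ 8 * ‖a‖ ^ 2 * (‖z - 0‖ ^ 3)⁻¹ := by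
      rw [e, sub_zero]
      calc ‖a‖ * ‖a - 1‖ / (‖z‖ * ‖z - 1‖ * ‖z - a‖)
          ≤ ‖a‖ * (2 * ‖a‖) / (‖z‖ * (‖z‖ / 2) * (‖z‖ / 2)) := by gcongr <;> linarith
        _ = _ := by field_simp; norm_num
    linarith

theorem integrable_of_norm_le {g : ℂ → ℂ} (hg : AEStronglyMeasurable g) {B : ℂ → ℝ}
    (hB : Integrable B) (h : ∀ z, ‖g z‖ ≤ B z) : Integrable g ∧ ∫ z, ‖g z‖ ≤ ∫ z, B z := by
  have hi : Integrable g := hB.mono' hg (Eventually.of_forall h)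
  exact ⟨hi, integral_mono hi.norm hB h⟩

theorem exists_integral_norm_gam_le :
    ∃ C : ℝ, 0 ≤ C ∧ ∀ a : ℂ, Integrable (gam a) ∧
      ∫ z, ‖gam a z‖ ≤ C * (1 + ‖a‖ * |Real.log ‖a‖|) := by
  refine ⟨2 * Real.pi * 200, by positivity, fun a => ?_⟩
  have pp := Real.pi_pos
  rcases le_or_gt ‖a‖ 4 with ha | ha
  · obtain ⟨i1, v1⟩ := radial_inv (R := 10) (by norm_num) 0
    obtain ⟨i2, v2⟩ := radial_inv (R := 11) (by norm_num) 1
    obtain ⟨i3, v3⟩ := radial_inv (R := 14) (by norm_num) a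
    obtain ⟨i4, v4⟩ := radial_inv_cube (R := 10) (by norm_num) 0
    have key := integrable_of_norm_le (measurable_gam a).aestronglyMeasurable
      ((((i1.const_mul 5).add (i2.const_mul 4)).add (i3.const_mul 1)).add (i4.const_mul 80))
      (norm_gam_le_of_norm_le ha)
    refine ⟨key.1, key.2.trans ?_⟩
    rw [integral_add' ((((i1.const_mul 5).add (i2.const_mul 4)).add (i3.const_mul 1)))
      (i4.const_mul 80), integral_add' ((i1.const_mul 5).add (i2.const_mul 4)) (i3.const_mul 1),
      integral_add' (i1.const_mul 5) (i2.const_mul 4)]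
    simp only [integral_const_mul]
    rw [v1, v2, v3, v4]
    have : 0 ≤ ‖a‖ * |Real.log ‖a‖| := by positivity
    nlinarith
  · have pa : 0 < ‖a‖ := by linarith
    obtain ⟨i1, v1⟩ := radial_inv (R := 3) (by norm_num) 0
    obtain ⟨i2, v2⟩ := radial_inv (R := 3) (by norm_num) 1
    obtain ⟨i3, v3⟩ := radial_inv_sq (s := 2) (t := ‖a‖) (by norm_num) (by linarith) 0
    obtain ⟨i4, v4⟩ := radial_inv (R := 3 * ‖a‖) (by positivity) a
    obtain ⟨i5, v5⟩ := radial_inv_cube (R := 2 * ‖a‖) (by positivity) 0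
    have j12 := (i1.const_mul (4 * ‖a‖)).add (i2.const_mul (4 * ‖a‖))
    have j3 := j12.add (i3.const_mul (8 * ‖a‖))
    have j4 := j3.add (i4.const_mul 16)
    have j5 := j4.add (i5.const_mul (8 * ‖a‖ ^ 2))
    have key := integrable_of_norm_le (measurable_gam a).aestronglyMeasurable j5
      (norm_gam_le_of_lt_norm ha)
    refine ⟨key.1, key.2.trans ?_⟩
    rw [integral_add' j4 (i5.const_mul (8 * ‖a‖ ^ 2)), integral_add' j3 (i4.const_mul 16),
      integral_add' j12 (i3.const_mul (8 * ‖a‖)),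
      integral_add' (i1.const_mul (4 * ‖a‖)) (i2.const_mul (4 * ‖a‖))]
    simp only [integral_const_mul]
    rw [v1, v2, v3, v4, v5]
    have l1 : 1 ≤ Real.log ‖a‖ := by
      rw [Real.le_log_iff_exp_le pa]
      exact (Real.exp_one_lt_d9.le.trans (by norm_num)).trans ha.le
    have l2 : Real.log (‖a‖ / 2) ≤ Real.log ‖a‖ :=
      Real.log_le_log (by positivity) (by linarith)
    rw [abs_of_nonneg (by linarith)]
    have e5 : 8 * ‖a‖ ^ 2 * (2 * Real.pi * (2 * ‖a‖)⁻¹) = 2 * Real.pi * (4 * ‖a‖) := by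
      field_simp; norm_num
    rw [e5]
    have q1 : ‖a‖ ≤ ‖a‖ * Real.log ‖a‖ := le_mul_of_one_le_right pa.le l1
    have q2 : ‖a‖ * Real.log (‖a‖ / 2) ≤ ‖a‖ * Real.log ‖a‖ := by gcongr
    have : 2 * Real.pi * (12 * ‖a‖ + 12 * ‖a‖ + 8 * (‖a‖ * Real.log (‖a‖ / 2)) + 48 * ‖a‖ + 4 * ‖a‖)
        ≤ 2 * Real.pi * (200 * (1 + ‖a‖ * Real.log ‖a‖)) := by gcongr; linarith
    linarith

/-! ### The pairing of φ with ∂̄h. -/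

/-- γ_a has residue 1 at a; its residues a - 1 at 0 and -a at 1 meet the zeros of h. -/
theorem integral_gam_mul_dbar {h : ℂ → ℂ} (hh : ContDiff ℝ 1 h) (hc : HasCompactSupport h)
    (h0 : h 0 = 0) (h1 : h 1 = 0) (a : ℂ) :
    ∫ z, gam a z * dbar h z = -Real.pi * h a := by
  have hi : ∀ p : ℂ, Integrable fun z => dbar h z / (z - p) := by
    intro p
    obtain ⟨M, hM⟩ := (continuous_dbar hh).bounded_above_of_compact_support (f := dbar h)
      (hc.mono' fun z hz => by
        by_contra h'
        exact hz (dbar_eq_zero_of_notMem_tsupport h'))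
    have hM0 : 0 ≤ M := (norm_nonneg _).trans (hM 0)
    obtain ⟨R, hR⟩ := hc.isCompact.isBounded.subset_ball p
    have hb := (radial_inv (le_max_right R 0) p).1.const_mul M
    refine hb.mono' ?_ (Eventually.of_forall fun z => ?_)
    · have := (continuous_dbar hh).measurable
      exact (by fun_prop : Measurable fun z => dbar h z / (z - p)).aestronglyMeasurable
    by_cases hz : z ∈ tsupport h ∧ z ≠ p
    · have h1 := hR hz.1
      rw [Metric.mem_ball, dist_eq_norm] at h1
      rw [indicator_of_mem (show ‖z - p‖ ∈ Ioc 0 (max R 0) from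
        ⟨norm_pos_iff.2 (sub_ne_zero.2 hz.2), h1.le.trans (le_max_left _ _)⟩), norm_div,
        div_eq_mul_inv]
      gcongr
      exact hM z
    · have : dbar h z / (z - p) = 0 := by
        by_cases hz' : z ∈ tsupport h
        · have : z = p := by tauto
          simp [this]
        · simp [dbar_eq_zero_of_notMem_tsupport hz']
      rw [this, norm_zero]
      exact mul_nonneg hM0 (indicator_apply_nonneg fun _ => by positivity)
  have e : (fun z => gam a z * dbar h z) =ᵐ[volume]
      (((fun z => (a - 1) * (dbar h z / (z - 0))) - fun z => a * (dbar h z / (z - 1))) +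
        fun z => dbar h z / (z - a)) := by
    have : ∀ p : ℂ, ∀ᵐ z : ℂ, z ≠ p := fun p => by simp [ae_iff]
    filter_upwards [this 0, this 1, this a] with z z0 z1 za
    simp only [Pi.add_apply, Pi.sub_apply, gam_partial_fractions z0 z1 za, sub_zero]; ring
  rw [integral_congr_ae e, integral_add' ((((hi 0).const_mul _).sub ((hi 1).const_mul _))) (hi a),
    integral_sub' ((hi 0).const_mul _) ((hi 1).const_mul _), integral_const_mul, integral_const_mul,
    integral_dbar_div_self hh hc, integral_dbar_div_self hh hc, integral_dbar_div_self hh hc,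
    h0, h1]
  ring

theorem integrable_tsum_of_summable_integral_norm {F : ℕ → ℂ → ℂ} (hF : ∀ n, Integrable (F n))
    (hs : Summable fun n => ∫ z, ‖F n z‖) : Integrable fun z => ∑' n, F n z := by
  have hfin : ∑' n, ∫⁻ z, ‖F n z‖ₑ ≠ ⊤ := by
    have : ∀ n, ∫⁻ z, ‖F n z‖ₑ = ENNReal.ofReal (∫ z, ‖F n z‖) := fun n =>
      (ofReal_integral_norm_eq_lintegral_enorm (hF n)).symm
    simp_rw [this]
    exact hs.tsum_ofReal_ne_top
  have hm : ∀ n, AEMeasurable (fun z => ‖F n z‖ₑ) := fun n => (hF n).1.enorm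
  rw [← lintegral_tsum hm] at hfin
  have hae : ∀ᵐ z, Summable fun n => F n z := by
    filter_upwards [ae_lt_top' (AEMeasurable.tsum hm) hfin] with z hz
    refine Summable.of_norm ?_
    have := ENNReal.summable_toReal hz.ne
    simpa using this
  refine ⟨?_, lt_of_le_of_lt (lintegral_mono fun z => enorm_tsum_le_tsum_enorm) hfin.lt_top⟩
  refine aestronglyMeasurable_of_tendsto_ae atTop
    (f := fun N z => ∑ n ∈ Finset.range N, F n z)
    (fun N => Finset.aestronglyMeasurable_fun_sum _ fun n _ => (hF n).1) ?_
  filter_upwards [hae] with z hz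
  exact hz.hasSum.tendsto_sum_nat

theorem integral_tsum_mul_dbar {l a : ℕ → ℂ}
    (hs : Summable fun n => ‖l n‖ * (1 + ‖a n‖ * |Real.log ‖a n‖|)) :
    Integrable (fun z => ∑' n, l n * gam (a n) z) ∧
      ∀ h : ℂ → ℂ, ContDiff ℝ 1 h → HasCompactSupport h → h 0 = 0 → h 1 = 0 →
        ∫ z, (∑' n, l n * gam (a n) z) * dbar h z = -Real.pi * ∑' n, l n * h (a n) := by
  obtain ⟨C, hC0, hC⟩ := exists_integral_norm_gam_le
  have hi : ∀ n, Integrable fun z => l n * gam (a n) z := fun n => (hC (a n)).1.const_mul _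
  have hle : ∀ n, ∫ z, ‖l n * gam (a n) z‖ ≤ C * (‖l n‖ * (1 + ‖a n‖ * |Real.log ‖a n‖|)) := by
    intro n
    simp only [norm_mul, integral_const_mul]
    calc ‖l n‖ * ∫ z, ‖gam (a n) z‖ ≤ ‖l n‖ * (C * (1 + ‖a n‖ * |Real.log ‖a n‖|)) := by
          gcongr; exact (hC (a n)).2
      _ = _ := by ring
  have hs1 : Summable fun n => ∫ z, ‖l n * gam (a n) z‖ :=
    (hs.mul_left C).of_nonneg_of_le (fun n => integral_nonneg fun z => norm_nonneg _) hle
  refine ⟨integrable_tsum_of_summable_integral_norm hi hs1, fun h hh hc h0 h1 => ?_⟩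
  obtain ⟨M, hM⟩ := (continuous_dbar hh).bounded_above_of_compact_support (f := dbar h)
    (hc.mono' fun z hz => by
      by_contra h'
      exact hz (dbar_eq_zero_of_notMem_tsupport h'))
  have hM0 : 0 ≤ M := (norm_nonneg _).trans (hM 0)
  have hi2 : ∀ n, Integrable fun z => l n * gam (a n) z * dbar h z := fun n =>
    (hi n).mul_bdd (c := M) (continuous_dbar hh).aestronglyMeasurable (Eventually.of_forall hM)
  have hs2 : Summable fun n => ∫ z, ‖l n * gam (a n) z * dbar h z‖ := by
    refine (hs1.mul_left M).of_nonneg_of_le (fun n => integral_nonneg fun z => norm_nonneg _)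
      fun n => ?_
    rw [← integral_const_mul]
    refine integral_mono (hi2 n).norm ((hi n).norm.const_mul M) fun z => ?_
    simp only
    rw [norm_mul _ (dbar h z), mul_comm]
    gcongr
    exact hM z
  have := (hasSum_integral_of_summable_integral_norm hi2 hs2).tsum_eq
  simp_rw [← tsum_mul_right]
  rw [← this, ← tsum_mul_left]
  congr 1
  ext n
  simp_rw [mul_assoc]
  rw [integral_const_mul, integral_gam_mul_dbar hh hc h0 h1]
  ring

/-! ### The mass at the base point, and the case of measure zero. -/

theorem iterate_add_deriv {f : ℂ → ℂ} (hf : Differentiable ℂ f) (d : ℂ) (m n : ℕ) :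
    deriv (f^[m + n]) d = deriv (f^[m]) (f^[n] d) * deriv (f^[n]) d := by
  rw [Function.iterate_add]
  exact deriv_comp d ((hf.iterate m) _) ((hf.iterate n) _)

/-- The total weight which the measure `∑ₙ δ_{fⁿ d} / (fⁿ)' d` gives to `d` is nonzero. -/
theorem mass_ne_zero {f : ℂ → ℂ} (hf : Differentiable ℂ f) {d : ℂ}
    (hs : Summable fun n => ‖1 / deriv (f^[n]) d‖) :
    ∑' n, 1 / deriv (f^[n]) d * (if f^[n] d = d then 1 else 0) ≠ 0 := by
  classical
  set l : ℕ → ℂ := fun n => 1 / deriv (f^[n]) d with hl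
  set t : ℕ → ℂ := fun n => l n * (if f^[n] d = d then 1 else 0) with ht
  have hts : Summable t := by
    refine Summable.of_norm (hs.of_nonneg_of_le (fun n => norm_nonneg _) fun n => ?_)
    simp only [ht, hl]
    split_ifs <;> simp
  have h0 : t 0 = 1 := by simp [ht, hl]
  by_cases hp : ∃ p, 0 < p ∧ f^[p] d = d
  · set p := Nat.find hp with hpdef
    obtain ⟨hp0, hpd⟩ := Nat.find_spec hp
    have hmin : ∀ n, 0 < n → n < p → f^[n] d ≠ d := fun n h1 h2 h3 => Nat.find_min hp h2 ⟨h1, h3⟩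
    have hsum : ∑ n ∈ Finset.range p, t n = 1 := by
      rw [Finset.sum_eq_single_of_mem 0 (Finset.mem_range.2 hp0), h0]
      intro n hn hn0
      simp [ht, hmin n (Nat.pos_of_ne_zero hn0) (Finset.mem_range.1 hn)]
    -- With p the least period, the chain rule is multiplicative along the cycle, so the mass m
    -- satisfies m = 1 + l_p m and cannot be 0.
    have hshift : ∀ n, t (n + p) = l p * t n := by
      intro n
      simp only [ht, hl]
      rw [iterate_add_deriv hf, hpd, Function.iterate_add_apply, hpd]
      rw [one_div, mul_inv]; ring
    have := hts.sum_add_tsum_nat_add p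
    rw [hsum] at this
    simp_rw [hshift, tsum_mul_left] at this
    intro h
    rw [h] at this
    simp at this
  · push Not at hp
    have : ∑' n, t n = t 0 := tsum_eq_single 0 fun n hn => by
      simp [ht, hp n (Nat.pos_of_ne_zero hn)]
    rw [this, h0]
    exact one_ne_zero

/-- On a bounded orbit x log x is bounded, so the first series suffices; otherwise the second
summability condition supplies the logarithmic weight. -/
theorem summable_weights {f : ℂ → ℂ} {c : ℂ} (hs : IsSummablePoint f c) :
    Summable fun n => ‖1 / deriv (f^[n]) (f c)‖ *
      (1 + ‖f^[n] (f c)‖ * |Real.log ‖f^[n] (f c)‖|) := by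
  have h1 : Summable fun n => ‖1 / deriv (f^[n]) (f c)‖ := by
    simpa using hs.summable_inv
  by_cases hb : Bornology.IsBounded (XSet f c)
  · obtain ⟨M, hM⟩ := hb.exists_norm_le
    obtain ⟨B, hB⟩ := (isCompact_Icc (a := 0) (b := M)).exists_bound_of_continuousOn
      Real.continuous_mul_log.continuousOn
    refine (h1.mul_right (1 + B)).of_nonneg_of_le (fun n => by positivity) fun n => ?_
    have : ‖f^[n] (f c)‖ ∈ Icc 0 M := ⟨norm_nonneg _, hM _ (subset_closure ⟨n, rfl⟩)⟩
    have := hB _ this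
    rw [Real.norm_eq_abs, abs_mul, abs_norm] at this
    gcongr
  · refine (h1.add (hs.summable_log hb)).congr fun n => ?_
    rw [norm_div, norm_one]; ring

theorem ruelleA_pairing {f : ℂ → ℂ} {c : ℂ} (hs : IsSummablePoint f c) :
    Integrable (ruelleA f (f c)) ∧
      ∀ h : ℂ → ℂ, ContDiff ℝ 1 h → HasCompactSupport h → h 0 = 0 → h 1 = 0 →
        ∫ z, ruelleA f (f c) z * dbar h z =
          -Real.pi * ∑' n, 1 / deriv (f^[n]) (f c) * h (f^[n] (f c)) := by
  have e : ruelleA f (f c) = fun z => ∑' n, 1 / deriv (f^[n]) (f c) * gam (f^[n] (f c)) z := by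
    ext z
    simp only [ruelleA]
    congr 1; ext n; ring
  rw [e]
  exact integral_tsum_mul_dbar (summable_weights hs)

/-- If test functions converge boundedly to the indicator of the base point of the orbit, their
pairings with `ruelleA` cannot tend to zero. -/
theorem not_tendsto_integral_zero {f : ℂ → ℂ} {c : ℂ} (hf : Differentiable ℂ f)
    (hs : IsSummablePoint f c) {h : ℕ → ℂ → ℂ} (hh : ∀ k, ContDiff ℝ 1 (h k))
    (hc : ∀ k, HasCompactSupport (h k)) (h0 : ∀ k, h k 0 = 0) (h1 : ∀ k, h k 1 = 0)
    {B : ℝ} (hB : ∀ k n, ‖h k (f^[n] (f c))‖ ≤ B) (hd : ∀ k, h k (f c) = 1)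
    (hz : ∀ n, f^[n] (f c) ≠ f c → Tendsto (fun k => h k (f^[n] (f c))) atTop (𝓝 0)) :
    ¬ Tendsto (fun k => ∫ z, ruelleA f (f c) z * dbar (h k) z) atTop (𝓝 0) := by
  intro ht
  have hsum : Summable fun n => ‖1 / deriv (f^[n]) (f c)‖ := by
    simpa using hs.summable_inv
  have hlim : Tendsto (fun k => ∑' n, 1 / deriv (f^[n]) (f c) * h k (f^[n] (f c))) atTop
      (𝓝 (∑' n, 1 / deriv (f^[n]) (f c) * (if f^[n] (f c) = f c then 1 else 0))) := by
    refine tendsto_tsum_of_dominated_convergence (hsum.mul_right B) (fun n => ?_)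
      (Eventually.of_forall fun k n => ?_)
    · refine Tendsto.const_mul _ ?_
      split_ifs with hn
      · rw [hn]; simp [hd]
      · exact hz n hn
    · rw [norm_mul]; gcongr; exact hB k n
  refine mass_ne_zero hf hsum ?_
  have e : ∀ k, ∑' n, 1 / deriv (f^[n]) (f c) * h k (f^[n] (f c)) =
      (-(Real.pi : ℂ))⁻¹ * ∫ z, ruelleA f (f c) z * dbar (h k) z := fun k => by
    rw [(ruelleA_pairing hs).2 (h k) (hh k) (hc k) (h0 k) (h1 k), ← mul_assoc,
      inv_mul_cancel₀ (neg_ne_zero.2 (ofReal_ne_zero.2 Real.pi_ne_zero)), one_mul]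
  simp_rw [e] at hlim
  have := tendsto_nhds_unique hlim (ht.const_mul _)
  rwa [mul_zero] at this

/-- A smooth cutoff function around `d`. -/
theorem exists_cutoff (d : ℂ) {r s : ℝ} (hr : 0 < r) (hrs : r < s) :
    ∃ χ : ℂ → ℂ, ContDiff ℝ 1 χ ∧ (∀ z, ‖χ z‖ ≤ 1) ∧ (∀ z ∈ Metric.closedBall d r, χ z = 1) ∧
      (∀ z ∉ Metric.ball d s, χ z = 0) ∧ tsupport χ = Metric.closedBall d s := by
  let b : ContDiffBump d := ⟨r, s, hr, hrs⟩
  refine ⟨fun z => (b z : ℂ), ofRealCLM.contDiff.comp b.contDiff, fun z => ?_, fun z hz => ?_,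
    fun z hz => ?_, ?_⟩
  · rw [norm_real, Real.norm_eq_abs, abs_of_nonneg b.nonneg]; exact b.le_one
  · simp [b.one_of_mem_closedBall hz]
  · have : b z = 0 := b.zero_of_le_dist (not_lt.1 hz)
    simp [this]
  · rw [← b.tsupport_eq, tsupport, tsupport]
    congr 1
    ext z; simp

/-- Bumps shrinking to the critical value isolate its mass, while every pairing with an almost
everywhere zero function is 0. -/
theorem not_ae_zero {f : ℂ → ℂ} {c : ℂ} (hf : Differentiable ℂ f)
    (hs : IsSummablePoint f c) (hd0 : f c ≠ 0) (hd1 : f c ≠ 1) :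
    ¬ ∀ᵐ z, ruelleA f (f c) z = 0 := by
  intro hae
  obtain ⟨ρ, hρ, hρ0, hρ1⟩ : ∃ ρ > 0, ρ < ‖0 - f c‖ ∧ ρ < ‖1 - f c‖ := by
    have p0 : 0 < ‖0 - f c‖ := norm_pos_iff.2 (sub_ne_zero.2 hd0.symm)
    have p1 : 0 < ‖1 - f c‖ := norm_pos_iff.2 (sub_ne_zero.2 hd1.symm)
    refine ⟨min ‖0 - f c‖ ‖1 - f c‖ / 2, by positivity, ?_, ?_⟩
    · linarith [min_le_left ‖0 - f c‖ ‖1 - f c‖]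
    · linarith [min_le_right ‖0 - f c‖ ‖1 - f c‖]
  have hk : ∀ k : ℕ, 0 < ρ / (k + 1) := fun k => by positivity
  have hkρ : ∀ k : ℕ, ρ / (k + 1) ≤ ρ := fun k => div_le_self hρ.le (by simp)
  choose h hh hb hone hzero hts using fun k : ℕ =>
    exists_cutoff (f c) (half_pos (hk k)) (half_lt_self (hk k))
  refine not_tendsto_integral_zero hf hs hh
    (fun k => by rw [HasCompactSupport, hts]; exact isCompact_closedBall _ _)
    (fun k => hzero k _ fun h' => ?_) (fun k => hzero k _ fun h' => ?_)
    (fun k n => hb k _) (fun k => hone k _ (Metric.mem_closedBall_self (half_pos (hk k)).le))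
    (fun n hn => ?_) ?_
  · rw [Metric.mem_ball, dist_eq_norm] at h'; linarith [hkρ k]
  · rw [Metric.mem_ball, dist_eq_norm] at h'; linarith [hkρ k]
  · refine tendsto_const_nhds.congr' ?_
    have ht : Tendsto (fun k : ℕ => ρ / ((k : ℝ) + 1)) atTop (𝓝 0) :=
      by simpa [div_eq_mul_inv] using (tendsto_one_div_add_atTop_nhds_zero_nat (𝕜 := ℝ)).const_mul ρ
    filter_upwards [ht.eventually_lt_const (dist_pos.2 hn)] with k hk'
    exact (hzero k _ fun h' => lt_asymm hk' h').symm
  · refine tendsto_const_nhds.congr fun k => ?_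
    rw [eq_comm]
    refine integral_eq_zero_of_ae ?_
    filter_upwards [hae] with z hz
    simp [hz]

/-! ### Peak functions attached to a slit. -/

/-- A path from p to q in D is stopped at its first arrival on the circle of radius 2ε and
subdivided so finely that the chords stay in D. -/
theorem exists_chain {D : Set ℂ} (hD : IsOpen D) (hc : IsPreconnected D) {d p q : ℂ} {ε : ℝ}
    (hp : p ∈ D) (hq : q ∈ D) (hpd : dist p d < ε) (hqd : 2 * ε ≤ dist q d) :
    ∃ (N : ℕ) (u : ℕ → ℂ), dist (u 0) d < ε ∧ dist (u N) d = 2 * ε ∧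
      (∀ i ≤ N, dist (u i) d ≤ 2 * ε) ∧ ∀ i < N, segment ℝ (u i) (u (i + 1)) ⊆ D := by
  have hε : 0 < ε := dist_nonneg.trans_lt hpd
  have hpc : IsPathConnected D := hD.isConnected_iff_isPathConnected.1 ⟨⟨p, hp⟩, hc⟩
  obtain ⟨γ, hγ⟩ := hpc.joinedIn p hp q hq
  set g : ℝ → ℂ := fun t => γ.extend t with hg
  have gc : Continuous g := γ.extend.continuous
  have gD : ∀ t, g t ∈ D := fun t =>
    hγ (projIcc 0 1 zero_le_one t)
  have g0 : g 0 = p := γ.extend_zero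
  have g1 : g 1 = q := γ.extend_one
  set T : Set ℝ := Icc 0 1 ∩ {t | dist (g t) d = 2 * ε} with hT
  have hTc : IsCompact T := isCompact_Icc.inter_right (isClosed_eq (by fun_prop) continuous_const)
  have ivt : ∀ s ∈ Icc (0 : ℝ) 1, 2 * ε ≤ dist (g s) d → ∃ t ∈ T, t ≤ s := by
    intro s hs h
    have := intermediate_value_Icc hs.1 (f := fun t => dist (g t) d) (by fun_prop)
    obtain ⟨t, ht, ht'⟩ := this (show 2 * ε ∈ Icc _ _ from ⟨by rw [g0]; linarith, h⟩)
    exact ⟨t, ⟨⟨ht.1, ht.2.trans hs.2⟩, ht'⟩, ht.2⟩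
  obtain ⟨t₁, ht₁, -⟩ := ivt 1 (by simp) (by rw [g1]; exact hqd)
  obtain ⟨s, hsT, hsmin⟩ := hTc.exists_isLeast ⟨t₁, ht₁⟩
  have hle : ∀ t ∈ Icc 0 s, dist (g t) d ≤ 2 * ε := by
    intro t ht
    by_contra! h
    obtain ⟨t', ht', hle⟩ := ivt t ⟨ht.1, ht.2.trans hsT.1.2⟩ h.le
    have h1 := hsmin ht'
    have : t' = t := le_antisymm hle (ht.2.trans h1)
    rw [← this, ht'.2] at h
    exact lt_irrefl _ h
  have hK : IsCompact (g '' Icc 0 1) := isCompact_Icc.image gc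
  obtain ⟨ρ, hρ, hρD⟩ := hK.exists_thickening_subset_open hD (by
    rintro _ ⟨t, -, rfl⟩; exact gD t)
  have huc := isCompact_Icc.uniformContinuousOn_of_continuous (gc.continuousOn (s := Icc (0 : ℝ) 1))
  obtain ⟨δ, hδ, hδ'⟩ := Metric.uniformContinuousOn_iff.1 huc ρ hρ
  obtain ⟨N, hN⟩ := exists_nat_gt (1 / δ)
  have hN0 : (0 : ℝ) < N := lt_trans (by positivity) hN
  have hs0 := hsT.1.1
  have hs1 := hsT.1.2
  have hmem : ∀ i ≤ N, (i : ℝ) / N * s ∈ Icc 0 s := fun i hi => by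
    have : (i : ℝ) / N ≤ 1 := by rw [div_le_one hN0]; exact_mod_cast hi
    exact ⟨by positivity, mul_le_of_le_one_left hs0 this⟩
  refine ⟨N, fun i => g ((i : ℝ) / N * s), by simpa [g0] using hpd, ?_, fun i hi => hle _ (hmem i hi),
    fun i hi => ?_⟩
  · simp only [div_self hN0.ne', one_mul]; exact hsT.2
  · have hi1 := hmem i hi.le
    have hi2 := hmem (i + 1) hi
    have hd := hδ' _ ⟨hi2.1, hi2.2.trans hs1⟩ _ ⟨hi1.1, hi1.2.trans hs1⟩ (by
      rw [Real.dist_eq]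
      have : ((i + 1 : ℕ) : ℝ) / N * s - (i : ℝ) / N * s = s / N := by push_cast; field_simp; ring
      rw [this, abs_of_nonneg (by positivity), div_lt_iff₀ hN0]
      rw [div_lt_iff₀ hδ] at hN
      linarith [mul_comm δ (N : ℝ)])
    refine Subset.trans (((convex_ball (g ((i : ℝ) / N * s)) ρ).segment_subset
      (Metric.mem_ball_self hρ) hd).trans fun z hz => ?_) hρD
    exact Metric.mem_thickening_iff.2 ⟨_, ⟨_, ⟨hi1.1, hi1.2.trans hs1⟩, rfl⟩, hz⟩

/-- The quotient is a nonpositive real exactly when z divides the segment from p to q. Each summand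
of `chainLog` is therefore holomorphic off its own segment. -/
theorem div_mem_slitPlane {z p q : ℂ} (h : z ∉ segment ℝ p q) : (z - p) / (z - q) ∈ slitPlane := by
  have hq : z - q ≠ 0 := fun h' => h (by rw [sub_eq_zero.1 h']; exact right_mem_segment ℝ p q)
  by_contra hn
  rw [mem_slitPlane_iff_not_le_zero, not_not] at hn
  set w := (z - p) / (z - q) with hw
  obtain ⟨hre, him⟩ := Complex.le_def.1 hn
  simp only [zero_re, zero_im] at hre him
  have hwr : w = (w.re : ℂ) := Complex.ext (by simp) (by simpa using him)
  set x : ℝ := -w.re with hx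
  have hx0 : 0 ≤ x := by linarith
  have hz : z - p = -(x : ℂ) * (z - q) := by
    have : -(x : ℂ) = w := by rw [hwr, hx]; simp
    rw [this, hw]; field_simp
  refine h ⟨1 / (1 + x), x / (1 + x), by positivity, by positivity, by field_simp, ?_⟩
  have : (1 + x : ℂ) ≠ 0 := by
    have : (1 + x : ℝ) ≠ 0 := by positivity
    exact_mod_cast this
  simp only [real_smul]
  push_cast
  field_simp
  linear_combination -hz

theorem norm_le_of_add_inv {w : ℂ} {M : ℝ} (hM : 0 ≤ M) (hw : ‖w + w⁻¹‖ ≤ M) : ‖w‖ ≤ M + 1 := by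
  rcases le_or_gt ‖w‖ 1 with h | h
  · linarith
  · have h1 : ‖w‖ - ‖w⁻¹‖ ≤ ‖w + w⁻¹‖ := by
      have := norm_sub_norm_le w (-w⁻¹)
      simpa using this
    have h2 : ‖w⁻¹‖ ≤ 1 := by rw [norm_inv]; exact inv_le_one_of_one_le₀ h.le
    linarith

/-- The exponent of the square root of `(z - u 0) / (z - u N)`, continued along a chain. -/
noncomputable def chainLog (u : ℕ → ℂ) (N : ℕ) (z : ℂ) : ℂ :=
  ∑ i ∈ Finset.range N, log ((z - u i) / (z - u (i + 1))) / 2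

/-- The function `(S - 1) / (S + 1)`, where `S` is the square root of `(z - u 0) / (z - u N)`. -/
noncomputable def chainFun (u : ℕ → ℂ) (N : ℕ) (z : ℂ) : ℂ :=
  (exp (chainLog u N z) - 1) / (exp (chainLog u N z) + 1)

theorem exp_chainLog_sq {u : ℕ → ℂ} {N : ℕ} {z : ℂ} (hz : ∀ i ≤ N, z ≠ u i) :
    exp (chainLog u N z) ^ 2 = (z - u 0) / (z - u N) := by
  induction N with
  | zero => simp [chainLog, div_self (sub_ne_zero.2 (hz 0 le_rfl))]
  | succ n ih =>
    have h1 := sub_ne_zero.2 (hz (n + 1) le_rfl)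
    have h2 := sub_ne_zero.2 (hz n (Nat.le_succ n))
    have e : exp (chainLog u (n + 1) z) =
        exp (chainLog u n z) * exp (log ((z - u n) / (z - u (n + 1))) / 2) := by
      rw [← exp_add, chainLog, Finset.sum_range_succ]; rfl
    rw [e, mul_pow, ih fun i hi => hz i (hi.trans (Nat.le_succ n)), ← exp_nat_mul]
    have : ((2 : ℕ) : ℂ) * (log ((z - u n) / (z - u (n + 1))) / 2) =
      log ((z - u n) / (z - u (n + 1))) := by push_cast; ring
    rw [this, exp_log (div_ne_zero h2 h1)]
    field_simp

/-- `chainFun` is a branch of the inverse Joukowski map for the slit: if w = (S - 1)/(S + 1), then w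
+ 1/w = 2(S² + 1)/(S² - 1), which is affine in z. -/
theorem chainFun_spec {u : ℕ → ℂ} {N : ℕ} {z : ℂ} (hz : ∀ i ≤ N, z ≠ u i) (hu : u 0 ≠ u N) :
    exp (chainLog u N z) + 1 ≠ 0 ∧ chainFun u N z ≠ 0 ∧
      chainFun u N z + (chainFun u N z)⁻¹ = 2 * (2 * z - u 0 - u N) / (u N - u 0) := by
  have h := exp_chainLog_sq hz
  set S := exp (chainLog u N z) with hS
  have hN := sub_ne_zero.2 (hz N le_rfl)
  have h' : S ^ 2 * (z - u N) = z - u 0 := by rw [h]; field_simp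
  have hne : S ^ 2 ≠ 1 := fun h1 => hu (by rw [h1] at h'; linear_combination h')
  have hp : S + 1 ≠ 0 := fun h1 => hne (by linear_combination (S - 1) * h1)
  have hm : S - 1 ≠ 0 := fun h1 => hne (by linear_combination (S + 1) * h1)
  refine ⟨hp, div_ne_zero hm hp, ?_⟩
  have hu' := sub_ne_zero.2 hu.symm
  simp only [chainFun, ← hS]
  rw [inv_div]
  field_simp
  linear_combination (-4 : ℂ) * h'

/-- A bound on w + 1/w bounds both w and 1/w, whatever the branch. Here |2z - u₀ - u_N| ≤ 20ε and
|u_N - u₀| ≥ ε give 40, hence 41 for each. -/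
theorem norm_chainFun_bounds {u : ℕ → ℂ} {N : ℕ} {d z : ℂ} {ε : ℝ} (hε : 0 < ε)
    (h0 : dist (u 0) d < ε) (hN : dist (u N) d = 2 * ε) (hz : ∀ i ≤ N, z ≠ u i)
    (hzd : dist z d ≤ 8 * ε) : ‖chainFun u N z‖ ≤ 41 ∧ ‖(chainFun u N z)⁻¹‖ ≤ 41 := by
  have hdist : ε ≤ ‖u N - u 0‖ := by
    rw [← dist_eq_norm]
    have := dist_triangle_right (u N) d (u 0)
    have := dist_triangle (u N) (u 0) d
    linarith
  have hu : u 0 ≠ u N := fun h => by rw [h, sub_self, norm_zero] at hdist; linarith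
  obtain ⟨-, hne, e⟩ := chainFun_spec hz hu
  have hb : ‖chainFun u N z + (chainFun u N z)⁻¹‖ ≤ 40 := by
    rw [e, norm_div, norm_mul]
    have : ‖2 * z - u 0 - u N‖ ≤ 20 * ε := by
      have e2 : 2 * z - u 0 - u N = 2 * (z - d) - (u 0 - d) - (u N - d) := by ring
      rw [e2]
      have a1 := norm_sub_le (2 * (z - d) - (u 0 - d)) (u N - d)
      have a2 := norm_sub_le (2 * (z - d)) (u 0 - d)
      rw [norm_mul, ← dist_eq_norm z, ← dist_eq_norm (u 0), RCLike.norm_ofNat] at a2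
      rw [← dist_eq_norm (u N)] at a1
      linarith
    rw [div_le_iff₀ (hε.trans_le hdist)]
    norm_num
    linarith
  have k1 := norm_le_of_add_inv (by norm_num) hb
  have k2 := norm_le_of_add_inv (w := (chainFun u N z)⁻¹) (M := 40) (by norm_num)
    (by rw [inv_inv, add_comm]; exact hb)
  constructor <;> linarith

theorem log_div_of_near_one {a b : ℂ} (ha : 0 < a.re) (hb : 0 < b.re) :
    log (a / b) = log a - log b := by
  have ha0 : a ≠ 0 := fun h => by simp [h] at ha
  have hb0 : b ≠ 0 := fun h => by simp [h] at hb
  have h1 := abs_lt.1 (abs_arg_lt_pi_div_two_iff.2 (Or.inl ha))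
  have h2 := abs_lt.1 (abs_arg_lt_pi_div_two_iff.2 (Or.inl hb))
  have hi : log b⁻¹ = -log b := log_inv b (by linarith [h2.2, Real.pi_pos])
  have hai : b⁻¹.arg = -b.arg := by
    have := congrArg im hi
    rwa [log_im, neg_im, log_im] at this
  rw [div_eq_mul_inv, log_mul ha0 (inv_ne_zero hb0), hi, sub_eq_add_neg]
  rw [hai]
  constructor <;> linarith

/-- Far from the chain all ratios (z - uᵢ)/(z - d) are near 1, so the principal logarithms telescope
and S is near 1. This selects the branch vanishing at infinity, with a constant independent of N. -/
theorem norm_chainFun_le_far {u : ℕ → ℂ} {N : ℕ} {d z : ℂ} {ε : ℝ}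
    (hu : ∀ i ≤ N, dist (u i) d ≤ 2 * ε) (hzd : 8 * ε < dist z d) :
    ‖chainFun u N z‖ ≤ 6 * ε / dist z d := by
  have hε : 0 ≤ ε := by linarith [dist_nonneg.trans (hu 0 (Nat.zero_le _))]
  have hz0 : 0 < dist z d := by linarith
  have hz1 : z - d ≠ 0 := by rw [dist_eq_norm] at hz0; exact norm_pos_iff.1 hz0
  set v : ℕ → ℂ := fun i => 1 + (d - u i) / (z - d) with hv
  have hvn : ∀ i ≤ N, ‖(d - u i) / (z - d)‖ ≤ 2 * ε / dist z d := fun i hi => by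
    rw [norm_div, ← dist_eq_norm, ← dist_eq_norm, dist_comm d]
    gcongr
    exact hu i hi
  have hq : 2 * ε / dist z d ≤ 1 / 4 := by rw [div_le_iff₀ hz0]; linarith
  have hre : ∀ i ≤ N, 0 < (v i).re := fun i hi => by
    have := (abs_re_le_norm _).trans ((hvn i hi).trans hq)
    have := (abs_le.1 this).1
    simp only [hv, add_re, one_re]; linarith
  have hlog : ∀ i ≤ N, ‖log (v i)‖ ≤ 3 / 2 * (2 * ε / dist z d) := fun i hi =>
    (norm_log_one_add_half_le_self (by linarith [hvn i hi])).trans (by gcongr; exact hvn i hi)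
  have hsum : chainLog u N z = (log (v 0) - log (v N)) / 2 := by
    have : ∀ i ∈ Finset.range N, log ((z - u i) / (z - u (i + 1))) / 2 =
        log (v i) / 2 - log (v (i + 1)) / 2 := fun i hi => by
      have hi' := Finset.mem_range.1 hi
      rw [← sub_div, ← log_div_of_near_one (hre i hi'.le) (hre (i + 1) hi')]
      have e : ∀ j, v j = (z - u j) / (z - d) := fun j => by simp only [hv]; field_simp; ring
      rw [e, e, div_div_div_cancel_right₀ hz1]
    rw [chainLog, Finset.sum_congr rfl this, Finset.sum_range_sub', sub_div]
  set x := chainLog u N z with hx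
  have hxn : ‖x‖ ≤ 3 * ε / dist z d := by
    rw [hsum, norm_div]
    have := norm_sub_le (log (v 0)) (log (v N))
    have h1 := hlog 0 (Nat.zero_le _)
    have h2 := hlog N le_rfl
    norm_num
    have e3 : 3 * ε / dist z d = 3 / 2 * (2 * ε / dist z d) := by ring
    rw [e3]; linarith
  have hxn' : ‖x‖ ≤ 3 / 8 := hxn.trans (by
    have e3 : 3 * ε / dist z d = 3 / 2 * (2 * ε / dist z d) := by ring
    rw [e3]; linarith)
  have he : ‖exp x - 1‖ ≤ 2 * ‖x‖ := norm_exp_sub_one_le (by linarith)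
  have hp : 1 ≤ ‖exp x + 1‖ := by
    have : (2 : ℂ) = (exp x + 1) - (exp x - 1) := by ring
    have h3 : ‖(2 : ℂ)‖ ≤ ‖exp x + 1‖ + ‖exp x - 1‖ := by
      conv_lhs => rw [this]
      exact norm_sub_le _ _
    norm_num at h3
    linarith
  rw [chainFun, norm_div]
  calc ‖exp x - 1‖ / ‖exp x + 1‖ ≤ ‖exp x - 1‖ := div_le_self (norm_nonneg _) hp
    _ ≤ 2 * ‖x‖ := he
    _ ≤ 2 * (3 * ε / dist z d) := by gcongr
    _ = _ := by ring

/-- Bounded functions, holomorphic off a compact subset of `D`, which peak at `d`. -/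
theorem exists_peak {D : Set ℂ} (hD : IsOpen D) (hc : IsPreconnected D) {d p q : ℂ} {ε : ℝ}
    (hp : p ∈ D) (hq : q ∈ D) (hpd : dist p d < ε) (hqd : 2 * ε ≤ dist q d) (hd : d ∉ D) :
    ∃ (E : Set ℂ) (J : ℂ → ℂ), IsCompact E ∧ E ⊆ D ∧ DifferentiableOn ℂ J Eᶜ ∧ J d = 1 ∧
      (∀ z ∉ D, ‖J z‖ ≤ 1681) ∧ ∀ z ∉ D, 8 * ε < dist z d → ‖J z‖ ≤ 246 * ε / dist z d := by
  have hε : 0 < ε := dist_nonneg.trans_lt hpd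
  obtain ⟨N, u, h0, hN, hu, hseg⟩ := exists_chain hD hc hp hq hpd hqd
  have hN0 : 0 < N := Nat.pos_of_ne_zero fun h => by rw [h] at hN; linarith
  set E : Set ℂ := ⋃ i ∈ Finset.range N, segment ℝ (u i) (u (i + 1)) with hE
  have hED : E ⊆ D := iUnion₂_subset fun i hi => hseg i (Finset.mem_range.1 hi)
  have hEs : ∀ z ∉ E, ∀ i < N, z ∉ segment ℝ (u i) (u (i + 1)) := fun z hz i hi h =>
    hz (mem_iUnion₂.2 ⟨i, Finset.mem_range.2 hi, h⟩)
  have hne : ∀ z ∉ E, ∀ i ≤ N, z ≠ u i := fun z hz i hi h => by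
    rcases hi.lt_or_eq with h' | h'
    · exact hEs z hz i h' (by rw [h]; exact left_mem_segment ℝ _ _)
    · obtain ⟨j, rfl⟩ := Nat.exists_eq_succ_of_ne_zero hN0.ne'
      exact hEs z hz j (Nat.lt_succ_self j) (by rw [h, h']; exact right_mem_segment ℝ _ _)
  have hune : u 0 ≠ u N := fun h => by rw [h] at h0; linarith
  have hdE : d ∉ E := fun h => hd (hED h)
  have hJd := norm_chainFun_bounds hε h0 hN (hne d hdE) (by rw [dist_self]; positivity)
  have hJd0 := (chainFun_spec (hne d hdE) hune).2.1
  -- Dividing by the value at d costs a factor 41, since `chainFun` is bounded below there: 1681 =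
  -- 41² and 246 = 6 · 41.
  refine ⟨E, fun z => chainFun u N z * (chainFun u N d)⁻¹, ?_, hED, ?_, mul_inv_cancel₀ hJd0,
    fun z hz => ?_, fun z hz hzd => ?_⟩
  · exact (Finset.range N).isCompact_biUnion fun i _ => by
      rw [segment_eq_image]; exact isCompact_Icc.image (by fun_prop)
  · refine DifferentiableOn.mul_const ?_ _
    intro z hz
    have hL : DifferentiableAt ℂ (chainLog u N) z := by
      unfold chainLog
      refine DifferentiableAt.fun_sum fun i hi => ?_
      have hi' := Finset.mem_range.1 hi
      have h1 := sub_ne_zero.2 (hne z hz (i + 1) hi')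
      have h2 : DifferentiableAt ℂ (fun z => (z - u i) / (z - u (i + 1))) z := by
        fun_prop (disch := assumption)
      exact (h2.clog (div_mem_slitPlane (hEs z hz i hi'))).div_const 2
    have h1 := (chainFun_spec (hne z hz) hune).1
    exact ((hL.cexp.sub_const 1).div (hL.cexp.add_const 1) h1).differentiableWithinAt
  · rw [norm_mul]
    have hzE : z ∉ E := fun h => hz (hED h)
    have : ‖chainFun u N z‖ ≤ 41 := by
      rcases le_or_gt (dist z d) (8 * ε) with h | h
      · exact (norm_chainFun_bounds hε h0 hN (hne z hzE) h).1
      · refine (norm_chainFun_le_far hu h).trans ?_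
        rw [div_le_iff₀ (by linarith)]; linarith
    calc _ ≤ 41 * (41 : ℝ) := by gcongr; exact hJd.2
      _ = _ := by norm_num
  · rw [norm_mul]
    have hz0 : 0 < dist z d := by linarith
    calc _ ≤ 6 * ε / dist z d * 41 := by
          gcongr
          · exact norm_chainFun_le_far hu hzd
          · exact hJd.2
      _ = _ := by ring

/-! ### Smooth modifications, and the contradiction from peak functions. -/

theorem dbar_congr {g h : ℂ → ℂ} {z : ℂ} (e : g =ᶠ[𝓝 z] h) : dbar g z = dbar h z := by
  simp only [dbar, e.fderiv_eq]

theorem dbar_const (w z : ℂ) : dbar (fun _ => w) z = 0 := by simp [dbar]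

theorem dbar_mul_holomorphic {χ J : ℂ → ℂ} {z : ℂ} (hχ : DifferentiableAt ℝ χ z)
    (hJ : DifferentiableAt ℂ J z) : dbar (fun w => χ w * J w) z = J z * dbar χ z := by
  have h1 := hJ.hasDerivAt.hasFDerivAt.restrictScalars ℝ
  have h2 := hχ.hasFDerivAt.mul h1
  have e : fderiv ℝ (fun w => χ w * J w) z = _ := h2.fderiv
  simp only [dbar, e]
  simp
  linear_combination (χ z * deriv J z / 2) * I_mul_I

theorem exists_zero_one_near {s t : Set ℂ} (hs : IsClosed s) (ht : IsClosed t)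
    (hd : Disjoint s t) : ∃ η : ℂ → ℂ, ContDiff ℝ 1 η ∧ (∀ z ∈ s, ∀ᶠ w in 𝓝 z, η w = 0) ∧
      ∀ z ∈ t, ∀ᶠ w in 𝓝 z, η w = 1 := by
  obtain ⟨η, h0, h1, -⟩ := exists_contMDiffMap_zero_one_nhds_of_isClosed (n := 1)
    (modelWithCornersSelf ℝ ℂ) hs ht hd
  refine ⟨fun z => (η z : ℂ), ofRealCLM.contDiff.comp η.contMDiff.contDiff, fun z hz => ?_,
    fun z hz => ?_⟩
  · filter_upwards [h0.filter_mono (nhds_le_nhdsSet hz)] with w hw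
    simp [hw]
  · filter_upwards [h1.filter_mono (nhds_le_nhdsSet hz)] with w hw
    simp [hw]

/-- A function which is smooth off a closed set `s` can be modified near `s` to become smooth. -/
theorem exists_smooth_modification {s t : Set ℂ} (hs : IsClosed s) (ht : IsClosed t)
    (hd : Disjoint s t) {g : ℂ → ℂ} (hg : ∀ z ∉ s, ContDiffAt ℝ 1 g z) :
    ∃ h : ℂ → ℂ, ContDiff ℝ 1 h ∧ (∀ z ∈ t, h =ᶠ[𝓝 z] g) ∧ ∀ z, g z = 0 → h z = 0 := by
  obtain ⟨η, hη, h0, h1⟩ := exists_zero_one_near hs ht hd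
  refine ⟨fun z => η z * g z, contDiff_iff_contDiffAt.2 fun z => ?_, fun z hz => ?_,
    fun z hz => by simp [hz]⟩
  · by_cases hz : z ∈ s
    · refine (contDiffAt_const (c := (0 : ℂ))).congr_of_eventuallyEq ?_
      filter_upwards [h0 z hz] with w hw
      simp [hw]
    · exact hη.contDiffAt.mul (hg z hz)
  · filter_upwards [h1 z hz] with w hw
    simp [hw]

theorem exists_radius_avoiding {d : ℂ} (hd0 : d ≠ 0) (hd1 : d ≠ 1) :
    ∃ ρ > 0, 0 ∉ Metric.closedBall d ρ ∧ 1 ∉ Metric.closedBall d ρ := by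
  have : ({0, 1} : Set ℂ)ᶜ ∈ 𝓝 d :=
    (Set.toFinite {0, 1}).isClosed.isOpen_compl.mem_nhds (by simp [hd0, hd1])
  obtain ⟨ρ, hρ, h⟩ := Metric.nhds_basis_closedBall.mem_iff.1 this
  exact ⟨ρ, hρ, fun h' => h h' (by simp), fun h' => h h' (by simp)⟩

theorem contDiffAt_of_differentiableOn {J : ℂ → ℂ} {U : Set ℂ} (hU : IsOpen U)
    (hJ : DifferentiableOn ℂ J U) {z : ℂ} (hz : z ∈ U) : ContDiffAt ℝ 1 J z :=
  ((hJ.analyticAt (hU.mem_nhds hz)).contDiffAt (n := 1)).restrict_scalars ℝ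

theorem exists_dbar_bound {χ : ℂ → ℂ} (hχ : ContDiff ℝ 1 χ) (hc : HasCompactSupport χ) :
    ∃ M, 0 ≤ M ∧ ∀ z, ‖dbar χ z‖ ≤ M := by
  obtain ⟨M, hM⟩ := (continuous_dbar hχ).bounded_above_of_compact_support (f := dbar χ)
    (hc.mono' fun z hz => by
      by_contra h'
      exact hz (dbar_eq_zero_of_notMem_tsupport h'))
  exact ⟨M, (norm_nonneg _).trans (hM 0), hM⟩

/-- `ruelleA` cannot vanish on connected open sets of definite size which come arbitrarily close to
the base point of the orbit. -/
theorem false_of_long_zero_sets {f : ℂ → ℂ} {c : ℂ} (hf : Differentiable ℂ f)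
    (hs : IsSummablePoint f c) (hd0 : f c ≠ 0) (hd1 : f c ≠ 1) {δ : ℝ} (hδ : 0 < δ)
    (h : ∀ ε, 0 < ε → ε < δ → ∃ D : Set ℂ, IsOpen D ∧ IsPreconnected D ∧
      (∀ n, f^[n] (f c) ∉ D) ∧ (∀ z ∈ D, z ≠ 0 → z ≠ 1 → ruelleA f (f c) z = 0) ∧
      (∃ p ∈ D, dist p (f c) < ε) ∧ ∃ q ∈ D, 2 * ε ≤ dist q (f c)) : False := by
  obtain ⟨ρ, hρ, hρ0, hρ1⟩ := exists_radius_avoiding hd0 hd1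
  obtain ⟨χ, χs, -, χ1, χ0, χt⟩ := exists_cutoff (f c) (half_pos hρ) (half_lt_self hρ)
  have χc : HasCompactSupport χ := by rw [HasCompactSupport, χt]; exact isCompact_closedBall _ _
  obtain ⟨M, hM0, hM⟩ := exists_dbar_bound χs χc
  -- The choice ρ/32 gives 8ε < ρ/2, so the decay of the peak functions applies wherever ∂̄χ can be
  -- nonzero.
  set δ' := min δ (ρ / 32) with hδ'
  have hδ'0 : 0 < δ' := by positivity
  set ε : ℕ → ℝ := fun k => δ' / ((k : ℝ) + 2) with hε
  have ε0 : ∀ k, 0 < ε k := fun k => by positivity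
  have εlt : ∀ k, ε k < δ' := fun k => div_lt_self hδ'0 (by
    have : (0 : ℝ) ≤ k := Nat.cast_nonneg k
    linarith)
  have εlim : Tendsto ε atTop (𝓝 0) :=
    tendsto_const_nhds.div_atTop (tendsto_natCast_atTop_atTop.atTop_add tendsto_const_nhds)
  choose D Do Dc Da Dz hp hq using fun k => h (ε k) (ε0 k) ((εlt k).trans_le (min_le_left _ _))
  choose p hpD hpd using hp
  choose q hqD hqd using hq
  choose E J Ec ED JE Jd Jb Jfar using fun k => exists_peak (Do k) (Dc k) (hpD k) (hqD k) (hpd k)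
    (hqd k) (Da k 0)
  have hsm : ∀ k, ∃ g : ℂ → ℂ, ContDiff ℝ 1 g ∧
      (∀ z ∈ (D k)ᶜ, g =ᶠ[𝓝 z] fun w => χ w * J k w) ∧ ∀ z, χ z * J k z = 0 → g z = 0 := fun k =>
    exists_smooth_modification (Ec k).isClosed (Do k).isClosed_compl
      (disjoint_compl_right_iff_subset.2 (ED k)) fun z hz =>
        χs.contDiffAt.mul (contDiffAt_of_differentiableOn (Ec k).isClosed.isOpen_compl (JE k) hz)
  choose g gs ge gz using hsm
  have gea : ∀ k n, g k (f^[n] (f c)) = χ (f^[n] (f c)) * J k (f^[n] (f c)) := fun k n =>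
    (ge k _ (Da k n)).self_of_nhds
  obtain ⟨B, hB⟩ := χs.continuous.bounded_above_of_compact_support χc
  have hB0 : 0 ≤ B := (norm_nonneg _).trans (hB 0)
  refine not_tendsto_integral_zero hf hs gs (fun k => χc.mono fun z hz hz' => hz (gz k z ?_))
    (fun k => gz k _ ?_) (fun k => gz k _ ?_) (B := B * 1681) (fun k n => ?_) (fun k => ?_)
    (fun n hn => ?_) ?_
  · rw [hz', zero_mul]
  · rw [χ0 _ fun h' => hρ0 (Metric.ball_subset_closedBall h'), zero_mul]
  · rw [χ0 _ fun h' => hρ1 (Metric.ball_subset_closedBall h'), zero_mul]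
  · rw [gea, norm_mul]
    gcongr
    exacts [hB _, Jb k _ (Da k n)]
  · have := gea k 0
    simp only [Function.iterate_zero, id] at this
    rw [this, Jd, χ1 _ (Metric.mem_closedBall_self (half_pos hρ).le), one_mul]
  · have hpos := dist_pos.2 hn
    have e1 : Tendsto (fun k => B * (246 * ε k / dist (f^[n] (f c)) (f c))) atTop (𝓝 0) := by
      have := ((εlim.const_mul 246).div_const (dist (f^[n] (f c)) (f c))).const_mul B
      simpa using this
    refine squeeze_zero_norm' ?_ e1
    have e2 : Tendsto (fun k => 8 * ε k) atTop (𝓝 0) := by simpa using εlim.const_mul 8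
    filter_upwards [e2.eventually_lt_const hpos] with k hk
    rw [gea, norm_mul]
    gcongr
    exacts [hB _, Jfar k _ (Da k n) hk]
  -- On D the function φ vanishes almost everywhere. Off D, ∂̄(χJ) = J ∂̄χ is zero on the inner
  -- disc, where χ = 1, and O(ε) outside it.
  · have hi := (ruelleA_pairing hs).1
    have e1 : Tendsto (fun k => (∫ z, ‖ruelleA f (f c) z‖) * (M * (246 * ε k / (ρ / 2)))) atTop
        (𝓝 0) := by
      have := (((εlim.const_mul 246).div_const (ρ / 2)).const_mul M).const_mul
        (∫ z, ‖ruelleA f (f c) z‖)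
      simpa using this
    refine squeeze_zero_norm (fun k => ?_) e1
    rw [← integral_mul_const]
    refine norm_integral_le_of_norm_le (hi.norm.mul_const _) ?_
    filter_upwards [compl_mem_ae_iff.2 (measure_singleton (0 : ℂ)),
      compl_mem_ae_iff.2 (measure_singleton (1 : ℂ))] with z hz0 hz1
    rw [norm_mul]
    by_cases hz : z ∈ D k
    · simp [Dz k z hz hz0 hz1]
    · gcongr
      have hzE : z ∈ (E k)ᶜ := fun h' => hz (ED k h')
      have hJz : DifferentiableAt ℂ (J k) z :=
        (JE k).differentiableAt ((Ec k).isClosed.isOpen_compl.mem_nhds hzE)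
      rw [dbar_congr (ge k z hz), dbar_mul_holomorphic (χs.differentiable one_ne_zero z) hJz,
        norm_mul, mul_comm]
      have hεk := (εlt k).trans_le (min_le_right _ _)
      by_cases hzr : z ∈ Metric.ball (f c) (ρ / 2)
      · have : dbar χ z = 0 := by
          rw [dbar_congr (h := fun _ => 1), dbar_const]
          filter_upwards [Metric.isOpen_ball.mem_nhds hzr] with w hw
          exact χ1 w (Metric.ball_subset_closedBall hw)
        rw [this, norm_zero, zero_mul]
        have := (ε0 k).le
        positivity
      · have hzr' : ρ / 2 ≤ dist z (f c) := not_lt.1 hzr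
        have := (ε0 k).le
        calc ‖dbar χ z‖ * ‖J k z‖ ≤ M * (246 * ε k / dist z (f c)) := by
              gcongr
              exacts [hM z, Jfar k z hz (by linarith)]
          _ ≤ _ := by gcongr

/-! ### Normal families and the position of the critical value. -/

/-- Montel's theorem for uniformly bounded holomorphic functions on a disc. -/
theorem exists_subseq_tendstoUniformlyOn {G : ℕ → ℂ → ℂ} {c : ℂ} {r M : ℝ} (hr : 0 < r)
    (hG : ∀ n, DifferentiableOn ℂ (G n) (Metric.ball c (2 * r)))
    (hM : ∀ n, ∀ z ∈ Metric.ball c (2 * r), ‖G n z‖ ≤ M) :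
    ∃ (t : ℕ → ℕ) (g : ℂ → ℂ), StrictMono t ∧
      TendstoUniformlyOn (fun k => G (t k)) g atTop (Metric.closedBall c r) := by
  set K := Metric.closedBall c r with hK
  have hKsub : K ⊆ Metric.ball c (2 * r) := Metric.closedBall_subset_ball (by linarith)
  have : CompactSpace K := isCompact_iff_compactSpace.1 (isCompact_closedBall c r)
  have hM0 : 0 ≤ M := (norm_nonneg _).trans (hM 0 c (Metric.mem_ball_self (by linarith)))
  let F : ℕ → BoundedContinuousFunction K ℂ := fun n =>
    BoundedContinuousFunction.mkOfCompact ⟨K.domRestrict (G n),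
      ((hG n).continuousOn.mono hKsub).domRestrict⟩
  have hF : ∀ n (x : K), F n x = G n x := fun n x => rfl
  have hderiv : ∀ n, ∀ z ∈ K, ‖deriv (G n) z‖ ≤ M / (r / 2) := by
    intro n z hz
    have hsub : Metric.closedBall z (r / 2) ⊆ Metric.ball c (2 * r) := fun w hw => by
      have h1 := Metric.mem_closedBall.1 hz
      have h2 := Metric.mem_closedBall.1 hw
      have := dist_triangle w z c
      rw [Metric.mem_ball]; linarith
    refine norm_deriv_le_of_forall_mem_sphere_norm_le (half_pos hr) ?_
      fun w hw => hM n w (hsub (Metric.sphere_subset_closedBall hw))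
    refine DifferentiableOn.diffContOnCl ((hG n).mono ?_)
    exact (closure_minimal Metric.ball_subset_closedBall Metric.isClosed_closedBall).trans hsub
  have hlip : ∀ n, ∀ x ∈ K, ∀ y ∈ K, dist (G n x) (G n y) ≤ M / (r / 2) * dist x y := by
    intro n x hx y hy
    rw [dist_eq_norm, dist_eq_norm]
    exact (convex_closedBall c r).norm_image_sub_le_of_norm_deriv_le
      (fun z hz => (hG n).differentiableAt (Metric.isOpen_ball.mem_nhds (hKsub hz)))
      (hderiv n) hy hx
  have hcomp : IsCompact (closure (range F)) := by
    refine BoundedContinuousFunction.arzela_ascoli (Metric.closedBall 0 M)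
      (isCompact_closedBall _ _) _ ?_ ?_
    · rintro _ x ⟨n, rfl⟩
      rw [mem_closedBall_zero_iff, hF]
      exact hM n _ (hKsub x.2)
    · refine Metric.equicontinuous_of_continuity_modulus (fun d => M / (r / 2) * d) ?_ _ ?_
      · have : Continuous fun d : ℝ => M / (r / 2) * d := by fun_prop
        simpa using this.tendsto 0
      · rintro x y ⟨_, ⟨n, rfl⟩⟩
        exact hlip n x x.2 y y.2
  obtain ⟨g, -, t, ht, hlim⟩ := hcomp.tendsto_subseq (x := F)
    fun n => subset_closure ⟨n, rfl⟩
  classical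
  refine ⟨t, fun z => if h : z ∈ K then g ⟨z, h⟩ else 0, ht, ?_⟩
  rw [Metric.tendstoUniformlyOn_iff]
  intro ε hε
  filter_upwards [Metric.tendsto_nhds.1 hlim ε hε] with k hk z hz
  simp only [hz, dif_pos]
  rw [dist_comm]
  exact (BoundedContinuousFunction.dist_coe_le_dist ⟨z, hz⟩).trans_lt hk

/-- A form of Hurwitz's theorem: limits of nonvanishing reciprocals of entire functions. -/
theorem limit_ne_zero {G H : ℕ → ℂ → ℂ} {g : ℂ → ℂ} {c : ℂ} {r : ℝ}
    (hH : ∀ n, Differentiable ℂ (H n)) (hGH : ∀ n, ∀ z ∈ Metric.ball c r, H n z * G n z = 1)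
    (hG : ∀ n, DifferentiableOn ℂ (G n) (Metric.ball c r))
    (hlim : TendstoUniformlyOn G g atTop (Metric.ball c r)) {z₁ : ℂ} (hz₁ : z₁ ∈ Metric.ball c r)
    (h₁ : g z₁ ≠ 0) : ∀ z ∈ Metric.ball c r, g z ≠ 0 := by
  intro z₀ hz₀ h₀
  have hgd : DifferentiableOn ℂ g (Metric.ball c r) :=
    hlim.tendstoLocallyUniformlyOn.differentiableOn (Eventually.of_forall hG) Metric.isOpen_ball
  have hga : AnalyticOnNhd ℂ g (Metric.ball c r) := hgd.analyticOnNhd Metric.isOpen_ball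
  rcases (hga z₀ hz₀).eventually_eq_zero_or_eventually_ne_zero with h | h
  · exact h₁ (hga.eqOn_zero_of_preconnected_of_eventuallyEq_zero
      (convex_ball c r).isPreconnected hz₀ h hz₁)
  rw [eventually_nhdsWithin_iff] at h
  obtain ⟨ρ, hρ, hρs⟩ := Metric.nhds_basis_closedBall.mem_iff.1
    (h.and (Metric.isOpen_ball.mem_nhds hz₀))
  have hsph : ∀ z ∈ Metric.sphere z₀ ρ, g z ≠ 0 := fun z hz =>
    (hρs (Metric.sphere_subset_closedBall hz)).1 (Metric.ne_of_mem_sphere hz hρ.ne')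
  have hball : Metric.closedBall z₀ ρ ⊆ Metric.ball c r := fun z hz => (hρs hz).2
  obtain ⟨w, hw, hmin⟩ := (isCompact_sphere z₀ ρ).exists_isMinOn
    (NormedSpace.sphere_nonempty.2 hρ.le) ((hgd.continuousOn.mono
      (Metric.sphere_subset_closedBall.trans hball)).norm)
  have hm : 0 < ‖g w‖ := norm_pos_iff.2 (hsph w hw)
  -- The maximum principle for H = 1/G carries the lower bound for |G| from the circle to its
  -- centre, so the limit cannot vanish there.
  have hGz : ∀ᶠ n in atTop, ‖g w‖ / 2 ≤ ‖G n z₀‖ := by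
    filter_upwards [Metric.tendstoUniformlyOn_iff.1 hlim _ (half_pos hm)] with n hn
    have hle : ∀ z ∈ Metric.sphere z₀ ρ, ‖H n z‖ ≤ 2 / ‖g w‖ := fun z hz => by
      have h1 := hn z (hball (Metric.sphere_subset_closedBall hz))
      have h2 : ‖g w‖ ≤ ‖g z‖ := hmin hz
      rw [dist_eq_norm] at h1
      have h3 := norm_sub_norm_le (g z) (G n z)
      have h4 : ‖H n z‖ * ‖G n z‖ = 1 := by
        rw [← norm_mul, hGH n z (hball (Metric.sphere_subset_closedBall hz)), norm_one]
      have h5 : ‖g w‖ / 2 ≤ ‖G n z‖ := by linarith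
      rw [le_div_iff₀ hm]
      nlinarith [norm_nonneg (H n z)]
    have h0 : ‖H n z₀‖ ≤ 2 / ‖g w‖ := by
      refine norm_le_of_forall_mem_frontier_norm_le (U := Metric.ball z₀ ρ) Metric.isBounded_ball
        (hH n).diffContOnCl (fun z hz => hle z ?_) (subset_closure (Metric.mem_ball_self hρ))
      rwa [frontier_ball z₀ hρ.ne'] at hz
    have h4 : ‖H n z₀‖ * ‖G n z₀‖ = 1 := by rw [← norm_mul, hGH n z₀ hz₀, norm_one]
    rw [le_div_iff₀ hm] at h0
    nlinarith [norm_nonneg (G n z₀)]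
  have := le_of_tendsto_of_tendsto tendsto_const_nhds (hlim.tendsto_at hz₀).norm hGz
  rw [h₀, norm_zero] at this
  linarith

/-- The functions 1/(fⁿ - w) are bounded by 1/δ, so Montel applies. By Hurwitz a subsequential limit
is either nowhere zero, giving a finite limit of iterates, or identically zero, giving divergence to
infinity. -/
theorem iteratesNormalOn_of_omit {f : ℂ → ℂ} (hf : Differentiable ℂ f) {c w : ℂ} {r δ : ℝ}
    (hr : 0 < r) (hδ : 0 < δ) (h : ∀ n, ∀ z ∈ Metric.ball c (2 * r), δ ≤ ‖f^[n] z - w‖) :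
    IteratesNormalOn f (Metric.ball c r) := by
  intro s
  have hne : ∀ n, ∀ z ∈ Metric.ball c (2 * r), f^[n] z - w ≠ 0 := fun n z hz h' => by
    have := h n z hz
    rw [h', norm_zero] at this; linarith
  have hsub : Metric.ball c r ⊆ Metric.ball c (2 * r) := Metric.ball_subset_ball (by linarith)
  have hGd : ∀ n, DifferentiableOn ℂ (fun z => (f^[n] z - w)⁻¹) (Metric.ball c (2 * r)) :=
    fun n => ((hf.iterate n).differentiableOn.sub_const w).inv (hne n)
  obtain ⟨t, g, ht, hlim⟩ := exists_subseq_tendstoUniformlyOn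
    (G := fun k z => (f^[s k] z - w)⁻¹) (M := δ⁻¹) hr (fun n => hGd (s n)) fun n z hz => by
      rw [norm_inv]; exact inv_anti₀ hδ (h _ z hz)
  replace hlim := hlim.mono (Metric.ball_subset_closedBall (x := c) (ε := r))
  refine ⟨t, ht, ?_⟩
  by_cases hg : ∃ z₁ ∈ Metric.ball c r, g z₁ ≠ 0
  · obtain ⟨z₁, hz₁, h₁⟩ := hg
    left
    have hnz := limit_ne_zero (H := fun k z => f^[s (t k)] z - w)
      (fun n => (hf.iterate _).sub_const w) (fun n z hz => mul_inv_cancel₀ (hne _ z (hsub hz)))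
      (fun n => (hGd _).mono hsub) hlim hz₁ h₁
    have hgd : DifferentiableOn ℂ g (Metric.ball c r) :=
      hlim.tendstoLocallyUniformlyOn.differentiableOn
        (Eventually.of_forall fun n => (hGd _).mono hsub) Metric.isOpen_ball
    have hinv := hlim.tendstoLocallyUniformlyOn.inv₀ hgd.continuousOn hnz
    refine ⟨fun z => (g z)⁻¹ + w, ?_⟩
    rw [Metric.tendstoLocallyUniformlyOn_iff] at hinv ⊢
    intro ε hε x hx
    obtain ⟨u, hu, hev⟩ := hinv ε hε x hx
    refine ⟨u, hu, hev.mono fun k hk y hy => ?_⟩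
    have := hk y hy
    simp only [Pi.inv_apply, inv_inv] at this
    rw [dist_eq_norm] at this ⊢
    convert this using 2
    ring
  · right
    push Not at hg
    intro K hK _ R
    have hε : 0 < (|R| + ‖w‖ + 1)⁻¹ := by positivity
    filter_upwards [Metric.tendstoUniformlyOn_iff.1 hlim _ hε] with k hk z hz
    have h1 := hk z (hK hz)
    rw [hg z (hK hz), dist_zero_left, norm_inv] at h1
    have h2 := norm_pos_iff.2 (hne (s (t k)) z (hsub (hK hz)))
    have h3 := (inv_lt_inv₀ h2 (by positivity)).1 h1
    have h4 := norm_sub_le (f^[s (t k)] z) w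
    have := le_abs_self R
    linarith

/-- If the closure of the critical orbit is not the whole plane, then the critical value is not an
interior point of it. -/
theorem notMem_interior_orbitClosure {f : ℂ → ℂ} (hf : Differentiable ℂ f) {c : ℂ}
    (hc : c ∈ juliaSet f) (hY : (orbitClosure f (f c))ᶜ.Nonempty) :
    f c ∉ interior (orbitClosure f (f c)) := by
  intro hint
  set X := orbitClosure f (f c) with hX
  have hXc : IsClosed X := isClosed_closure
  have hmap : ∀ z ∈ X, f z ∈ X := by
    intro z hz
    refine map_mem_closure hf.continuous hz ?_
    rintro _ ⟨n, rfl⟩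
    exact ⟨n + 1, Function.iterate_succ_apply' f n _⟩
  have hmapn : ∀ n, ∀ z ∈ X, f^[n] z ∈ X := by
    intro n
    induction n with
    | zero => exact fun z hz => hz
    | succ n ih => exact fun z hz => by rw [Function.iterate_succ_apply]; exact ih _ (hmap z hz)
  -- The point w must also differ from c: the zeroth iterate of a point near c need not lie in X,
  -- and is kept away from w by distance alone.
  obtain ⟨w, hwX, hwc⟩ : ∃ w ∈ Xᶜ, w ≠ c := by
    obtain ⟨y, hy⟩ := hY
    by_contra! h
    have h1 : Xᶜ ∩ {c}ᶜ ∈ 𝓝[≠] y := inter_mem (mem_nhdsWithin_of_mem_nhds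
      (hXc.isOpen_compl.mem_nhds hy)) (by rw [← h y hy]; exact self_mem_nhdsWithin)
    obtain ⟨z, hz⟩ := (inferInstance : (𝓝[≠] y).NeBot).nonempty_of_mem h1
    exact hz.2 (h z hz.1)
  obtain ⟨δ, hδ, hδs⟩ := Metric.isOpen_iff.1 hXc.isOpen_compl w hwX
  have hev : ∀ᶠ z in 𝓝 c, f z ∈ interior X ∧ dist w c / 2 < dist z w := by
    refine (hf.continuous.continuousAt.eventually (isOpen_interior.mem_nhds hint)).and ?_
    have : ContinuousAt (fun z => dist z w) c := by fun_prop
    refine this.eventually (lt_mem_nhds ?_)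
    simp only [dist_comm c w]; exact half_lt_self (dist_pos.2 hwc)
  obtain ⟨r, hr, hrs⟩ := Metric.mem_nhds_iff.1 hev
  have hmin : 0 < min δ (dist w c / 2) := lt_min hδ (half_pos (dist_pos.2 hwc))
  refine hc ⟨Metric.ball c (r / 2), Metric.isOpen_ball, Metric.mem_ball_self (half_pos hr),
    iteratesNormalOn_of_omit hf (half_pos hr) hmin (w := w) fun n z hz => ?_⟩
  have hz' := hrs (by simpa [mul_div_cancel₀] using hz)
  rw [← dist_eq_norm]
  cases n with
  | zero => exact (min_le_right _ _).trans hz'.2.le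
  | succ n =>
    refine (min_le_left _ _).trans (not_lt.1 fun h' => hδs h' ?_)
    rw [Function.iterate_succ_apply]
    exact hmapn n _ (interior_subset hz'.1)

/-! ### Path lifting in the absence of asymptotic values. -/

/-- The points where `f` is locally invertible. -/
abbrev RegPt (f : ℂ → ℂ) : Type := {z : ℂ // deriv f z ≠ 0}

/-- The restriction of `f` to its regular points. -/
def regMap (f : ℂ → ℂ) (z : RegPt f) : ℂ := f z

theorem exists_local_inverse {f : ℂ → ℂ} (hf : Differentiable ℂ f) {z : ℂ} (hz : deriv f z ≠ 0) :
    ∃ e : OpenPartialHomeomorph ℂ ℂ, z ∈ e.source ∧ ⇑e = f := by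
  have h : HasStrictDerivAt f (deriv f z) z := (hf.analyticAt z).hasStrictDerivAt
  have h' := h.hasStrictFDerivAt_equiv hz
  exact ⟨h'.toOpenPartialHomeomorph f, h'.mem_toOpenPartialHomeomorph_source,
    h'.toOpenPartialHomeomorph_coe⟩

theorem isOpen_regPt {f : ℂ → ℂ} (hf : Differentiable ℂ f) : IsOpen {z | deriv f z ≠ 0} :=
  isOpen_ne_fun ((hf.contDiff (n := 1)).continuous_deriv le_rfl) continuous_const

theorem isLocalHomeomorph_regMap {f : ℂ → ℂ} (hf : Differentiable ℂ f) :
    IsLocalHomeomorph (regMap f) := by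
  have h1 : IsLocalHomeomorphOn f {z | deriv f z ≠ 0} := IsLocalHomeomorphOn.mk _ _ fun z hz => by
    obtain ⟨e, he, hef⟩ := exists_local_inverse hf hz
    exact ⟨e, he, fun w _ => by rw [hef]⟩
  have h2 : IsLocalHomeomorph (Subtype.val : RegPt f → ℂ) :=
    (isOpen_regPt hf).isOpenEmbedding_subtypeVal.isLocalHomeomorph
  rw [isLocalHomeomorph_iff_isLocalHomeomorphOn_univ] at h2 ⊢
  exact h1.comp h2 fun z _ => z.2

theorem lift_unique {f : ℂ → ℂ} (hf : Differentiable ℂ f) {S : Set ℝ} (hS : IsPreconnected S)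
    {g₁ g₂ : ℝ → RegPt f} (h₁ : ContinuousOn g₁ S) (h₂ : ContinuousOn g₂ S)
    (he : ∀ t ∈ S, f (g₁ t) = f (g₂ t)) {a : ℝ} (ha : a ∈ S) (hag : g₁ a = g₂ a) : EqOn g₁ g₂ S :=
  (T2Space.isSeparatedMap (regMap f)).eqOn_of_comp_eqOn
    (isLocalHomeomorph_regMap hf).isLocallyInjective hS h₁ h₂ he ha hag

/-- A path `β`, parametrised by `[0, 1]`, lifts up to time `s`. -/
def LiftsUpTo (f : ℂ → ℂ) (β : ℝ → ℂ) (y : RegPt f) (s : ℝ) (g : ℝ → RegPt f) : Prop :=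
  ContinuousOn g (Icc 0 s) ∧ (∀ t ∈ Icc 0 s, f (g t) = β t) ∧ g 0 = y

theorem LiftsUpTo.mono {f : ℂ → ℂ} {β : ℝ → ℂ} {y : RegPt f} {s s' : ℝ} {g : ℝ → RegPt f}
    (h : LiftsUpTo f β y s g) (hs : s' ≤ s) : LiftsUpTo f β y s' g :=
  ⟨h.1.mono (Icc_subset_Icc_right hs), fun t ht => h.2.1 t (Icc_subset_Icc_right hs ht), h.2.2⟩

theorem LiftsUpTo.eq {f : ℂ → ℂ} (hf : Differentiable ℂ f) {β : ℝ → ℂ} {y : RegPt f} {s : ℝ}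
    {g₁ g₂ : ℝ → RegPt f} (h₁ : LiftsUpTo f β y s g₁) (h₂ : LiftsUpTo f β y s g₂) {t : ℝ}
    (ht : t ∈ Icc 0 s) : g₁ t = g₂ t :=
  lift_unique hf isPreconnected_Icc h₁.1 h₂.1 (fun t ht => by rw [h₁.2.1 t ht, h₂.2.1 t ht])
    (left_mem_Icc.2 (ht.1.trans ht.2)) (by rw [h₁.2.2, h₂.2.2]) ht

/-- A curve on which `f` converges at the end has a finite cluster point there. -/
theorem exists_clusterPt_of_lift {f : ℂ → ℂ} (hf : Continuous f)
    (hna : ∀ a, ¬ IsAsymptoticValue f a) {T : ℝ} (hT : 0 < T) {Λ : ℝ → ℂ} {b : ℂ}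
    (hΛ : ContinuousOn Λ (Ico 0 T)) (hb : Tendsto (fun t => f (Λ t)) (𝓝[<] T) (𝓝 b)) :
    ∃ y, f y = b ∧ MapClusterPt y (𝓝[<] T) Λ := by
  have hnt : ¬ Tendsto Λ (𝓝[<] T) (cocompact ℂ) := by
    intro hinf
    -- This reparametrises [0, T) by [0, ∞): a lift escaping to infinity at T would exhibit b as an
    -- asymptotic value.
    set φ : ℝ → ℝ := fun s => T - T / (1 + s) with hφ
    have hφm : ∀ s ∈ Ici (0 : ℝ), φ s ∈ Ico 0 T := fun s hs => by
      have hs' : (0 : ℝ) ≤ s := hs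
      have h1 : T / (1 + s) ≤ T := div_le_self hT.le (by linarith)
      have h2 : 0 < T / (1 + s) := by positivity
      exact ⟨by simp only [hφ]; linarith, by simp only [hφ]; linarith⟩
    have hφc : ContinuousOn φ (Ici 0) := by
      refine continuousOn_const.sub (continuousOn_const.div (by fun_prop) fun s hs => ?_)
      have hs' : (0 : ℝ) ≤ s := hs
      positivity
    have hφt : Tendsto φ atTop (𝓝[<] T) := by
      rw [tendsto_nhdsWithin_iff]
      constructor
      · have : Tendsto (fun s : ℝ => T / (1 + s)) atTop (𝓝 0) :=
          tendsto_const_nhds.div_atTop (tendsto_atTop_add_const_left _ _ tendsto_id)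
        simpa using this.const_sub T
      · filter_upwards [eventually_ge_atTop 0] with s hs
        exact (hφm s hs).2
    exact hna b ⟨fun s => Λ (φ s), hΛ.comp hφc hφm, hinf.comp hφt, hb.comp hφt⟩
  rw [Tendsto, Filter.le_def] at hnt
  push Not at hnt
  obtain ⟨V, hV, hV'⟩ := hnt
  obtain ⟨K, hK, hKV⟩ := mem_cocompact.1 hV
  have hfreq : ∃ᶠ t in 𝓝[<] T, Λ t ∈ K := by
    intro h
    refine hV' (mem_map.2 ?_)
    filter_upwards [h] with t ht
    exact hKV ht
  obtain ⟨y, -, hy⟩ := hK.exists_mapClusterPt_of_frequently hfreq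
  refine ⟨y, ?_, hy⟩
  have h1 : MapClusterPt (f y) (𝓝[<] T) (f ∘ Λ) := hy.continuousAt_comp hf.continuousAt
  have h2 : ClusterPt (f y) (𝓝 b) := ClusterPt.mono h1 hb
  exact eq_of_nhds_neBot h2

/-- Let T be the supremum of the times up to which β lifts. Since β(T) is not an asymptotic value,
the lift clusters at a finite point over β(T); that point is regular, so a local inverse continues
the lift past T unless T = 1. -/
theorem exists_lift {f : ℂ → ℂ} (hf : Differentiable ℂ f) (hna : ∀ a, ¬ IsAsymptoticValue f a)
    {β : ℝ → ℂ} (hβ : Continuous β) (hreg : ∀ t ∈ Icc (0 : ℝ) 1, ∀ z, f z = β t → deriv f z ≠ 0)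
    (y : RegPt f) (hy : f y = β 0) : ∃ g, LiftsUpTo f β y 1 g := by
  classical
  set S : Set ℝ := {s | s ∈ Icc (0 : ℝ) 1 ∧ ∃ g, LiftsUpTo f β y s g} with hS
  have h0S : (0 : ℝ) ∈ S := by
    refine ⟨by simp, fun _ => y, continuousOn_const, fun t ht => ?_, rfl⟩
    rw [Icc_self, mem_singleton_iff] at ht
    rw [ht, hy]
  have hbdd : BddAbove S := ⟨1, fun s hs => hs.1.2⟩
  have hdown : ∀ s ∈ S, ∀ s', 0 ≤ s' → s' ≤ s → s' ∈ S := fun s hs s' h0 hle =>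
    ⟨⟨h0, hle.trans hs.1.2⟩, hs.2.imp fun g hg => hg.mono hle⟩
  set T := sSup S with hT
  have hT0 : 0 ≤ T := le_csSup hbdd h0S
  have hT1 : T ≤ 1 := csSup_le ⟨0, h0S⟩ fun s hs => hs.1.2
  have hex : ∀ s, ∃ g, s ∈ S → LiftsUpTo f β y s g := fun s => by
    by_cases h : s ∈ S
    · exact h.2.imp fun g hg _ => hg
    · exact ⟨fun _ => y, fun h' => absurd h' h⟩
  choose G hG using hex
  set Λ : ℝ → RegPt f := fun t => G t t with hΛ
  have hΛG : ∀ s ∈ S, ∀ t ∈ Icc 0 s, Λ t = G s t := fun s hs t ht =>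
    LiftsUpTo.eq hf (hG t (hdown s hs t ht.1 ht.2)) ((hG s hs).mono ht.2) (right_mem_Icc.2 ht.1)
  have hΛf : ∀ t ∈ S, f (Λ t) = β t := fun t ht => (hG t ht).2.1 t (right_mem_Icc.2 ht.1.1)
  have hΛc : ∀ s ∈ S, ContinuousOn Λ (Icc 0 s) := fun s hs => (hG s hs).1.congr (hΛG s hs)
  obtain ⟨w, hfw, hw⟩ : ∃ w : ℂ, f w = β T ∧ ∀ N ∈ 𝓝 w, ∀ η > 0, ∃ t ∈ S, T - η < t ∧
      (Λ t : ℂ) ∈ N := by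
    by_cases hTS : T ∈ S
    · exact ⟨Λ T, hΛf T hTS, fun N hN η hη => ⟨T, hTS, by linarith, mem_of_mem_nhds hN⟩⟩
    have hTpos : 0 < T := lt_of_le_of_ne hT0 fun h => hTS (h ▸ h0S)
    have hlt : ∀ t ∈ Ico 0 T, t ∈ S := fun t ht => by
      obtain ⟨s, hs, hts⟩ := exists_lt_of_lt_csSup ⟨0, h0S⟩ ht.2
      exact hdown s hs t ht.1 hts.le
    have hcont : ContinuousOn (fun t => (Λ t : ℂ)) (Ico 0 T) := by
      intro t ht
      obtain ⟨s, hs, hts⟩ := exists_lt_of_lt_csSup ⟨0, h0S⟩ ht.2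
      have h1 := (continuous_subtype_val.comp_continuousOn (hΛc s hs)) t ⟨ht.1, hts.le⟩
      refine h1.mono_of_mem_nhdsWithin ?_
      filter_upwards [self_mem_nhdsWithin, mem_nhdsWithin_of_mem_nhds (Iio_mem_nhds hts)]
        with x hx hx'
      exact ⟨hx.1, le_of_lt hx'⟩
    have hev : ∀ᶠ t in 𝓝[<] T, t ∈ Ico 0 T := Ico_mem_nhdsLT hTpos
    have hb : Tendsto (fun t => f (Λ t)) (𝓝[<] T) (𝓝 (β T)) := by
      refine (hβ.continuousAt.mono_left nhdsWithin_le_nhds).congr' ?_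
      filter_upwards [hev] with t ht
      exact (hΛf t (hlt t ht)).symm
    obtain ⟨w, hfw, hw⟩ := exists_clusterPt_of_lift hf.continuous hna hTpos hcont hb
    refine ⟨w, hfw, fun N hN η hη => ?_⟩
    have h1 : ∀ᶠ t in 𝓝[<] T, T - η < t :=
      mem_nhdsWithin_of_mem_nhds (Ioi_mem_nhds (by linarith))
    obtain ⟨t, ht, ht1, ht2⟩ := ((hw.frequently hN).and_eventually (h1.and hev)).exists
    exact ⟨t, hlt t ht2, ht1, ht⟩
  obtain ⟨e, hew, hef⟩ := exists_local_inverse hf (hreg T ⟨hT0, hT1⟩ w hfw)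
  have htar : β ⁻¹' e.target ∈ 𝓝 T := by
    refine hβ.continuousAt.preimage_mem_nhds (e.open_target.mem_nhds ?_)
    rw [← hfw, ← hef]; exact e.map_source hew
  obtain ⟨η, hη, hηs⟩ := Metric.mem_nhds_iff.1 htar
  obtain ⟨t₀, ht₀S, ht₀, ht₀w⟩ := hw _ (e.open_source.mem_nhds hew) η hη
  have ht₀T : t₀ ≤ T := le_csSup hbdd ht₀S
  -- The local inverse is followed from a time t₀ at which the lift is already in its domain. A
  -- value of s₁ below 1 would exceed the supremum T.
  set s₁ := min 1 (T + η / 2) with hs₁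
  have hTs₁ : T ≤ s₁ := le_min hT1 (by linarith)
  have hβt : ∀ t ∈ Icc t₀ s₁, β t ∈ e.target := fun t ht => hηs (by
    have := ht.2.trans (min_le_right _ _)
    rw [Metric.mem_ball, Real.dist_eq, abs_lt]
    constructor <;> linarith [ht.1])
  have hsymm : ∀ t ∈ Icc t₀ s₁, f (e.symm (β t)) = β t := fun t ht => by
    rw [← hef]; exact e.right_inv (hβt t ht)
  have hd : ∀ t ∈ Icc t₀ s₁, deriv f (e.symm (β t)) ≠ 0 := fun t ht =>
    hreg t ⟨ht₀S.1.1.trans ht.1, ht.2.trans (min_le_left _ _)⟩ _ (hsymm t ht)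
  set k : ℝ → RegPt f := fun t =>
    if h : deriv f (e.symm (β t)) ≠ 0 then ⟨e.symm (β t), h⟩ else y with hk
  have hkv : ∀ t ∈ Icc t₀ s₁, (k t : ℂ) = e.symm (β t) := fun t ht => by
    simp only [hk, dif_pos (hd t ht)]
  have hkc : ContinuousOn k (Icc t₀ s₁) := by
    have hind : Topology.IsInducing (Subtype.val : RegPt f → ℂ) := Topology.IsInducing.subtypeVal
    refine hind.continuousOn_iff.2 ?_
    exact (e.continuousOn_symm.comp hβ.continuousOn hβt).congr hkv
  have hglue : k t₀ = Λ t₀ := by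
    refine Subtype.ext ?_
    rw [hkv t₀ ⟨le_rfl, ht₀T.trans hTs₁⟩, ← hΛf t₀ ht₀S, ← congrFun hef (Λ t₀)]
    exact e.left_inv ht₀w
  have hs₁S : s₁ ∈ S := by
    refine ⟨⟨hT0.trans hTs₁, min_le_left _ _⟩, fun t => if t ≤ t₀ then Λ t else k t, ?_, ?_, ?_⟩
    · have hu : Icc 0 s₁ = Icc 0 t₀ ∪ Icc t₀ s₁ :=
        (Icc_union_Icc_eq_Icc ht₀S.1.1 (ht₀T.trans hTs₁)).symm
      rw [hu]
      refine ContinuousOn.union_of_isClosed ?_ ?_ isClosed_Icc isClosed_Icc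
      · exact (hΛc t₀ ht₀S).congr fun t ht => if_pos ht.2
      · refine hkc.congr fun t ht => ?_
        rcases ht.1.eq_or_lt with h | h
        · simp only [← h, le_rfl, if_true, hglue]
        · simp only [not_le.2 h, if_false]
    · intro t ht
      by_cases h : t ≤ t₀
      · simp only [h, if_true]
        exact hΛf t (hdown t₀ ht₀S t ht.1 h)
      · simp only [h, if_false]
        have ht' : t ∈ Icc t₀ s₁ := ⟨(not_le.1 h).le, ht.2⟩
        rw [hkv t ht', hsymm t ht']
    · simp only [ht₀S.1.1, if_true]
      exact (hG 0 h0S).2.2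
  have hle := le_csSup hbdd hs₁S
  have : s₁ = 1 := by
    by_contra hne
    have h1 : s₁ = T + η / 2 := (min_choice 1 (T + η / 2)).resolve_left hne
    rw [h1] at hle
    linarith
  rw [this] at hs₁S
  exact hs₁S.2

/-! ### Radial lifting and compact pieces of the preimage of a disc. -/

/-- The points mapped by `f` into the punctured disc of radius `R` around `d`. -/
def puncPre (f : ℂ → ℂ) (d : ℂ) (R : ℝ) : Set ℂ := {z | f z ∈ Metric.ball d R ∧ f z ≠ d}

/-- The point at distance `ρ` from `d` in the direction of `w`. -/
noncomputable def radialPt (d w : ℂ) (ρ : ℝ) : ℂ := d + (ρ / ‖w - d‖ : ℝ) * (w - d)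

theorem dist_radialPt {d w : ℂ} (hw : w ≠ d) {ρ : ℝ} (hρ : 0 ≤ ρ) : dist (radialPt d w ρ) d = ρ := by
  have := norm_pos_iff.2 (sub_ne_zero.2 hw)
  rw [dist_eq_norm, radialPt, add_sub_cancel_left, norm_mul, norm_real, Real.norm_eq_abs,
    abs_of_nonneg (by positivity)]
  field_simp

theorem radialPt_self {d w : ℂ} (hw : w ≠ d) : radialPt d w (dist w d) = w := by
  have := norm_pos_iff.2 (sub_ne_zero.2 hw)
  rw [dist_eq_norm, radialPt, div_self this.ne']
  simp

theorem radialPt_radialPt {d w : ℂ} (hw : w ≠ d) {ρ : ℝ} (hρ : 0 < ρ) (ρ' : ℝ) :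
    radialPt d (radialPt d w ρ) ρ' = radialPt d w ρ' := by
  have h1 := norm_pos_iff.2 (sub_ne_zero.2 hw)
  have h2 : ‖radialPt d w ρ - d‖ = ρ := by rw [← dist_eq_norm]; exact dist_radialPt hw hρ.le
  have h3 : (‖w - d‖ : ℂ) ≠ 0 := ofReal_ne_zero.2 h1.ne'
  have h4 : (ρ : ℂ) ≠ 0 := ofReal_ne_zero.2 hρ.ne'
  rw [radialPt, h2, radialPt, radialPt]
  push_cast
  field_simp
  ring

/-- Target distances and starting points of radial lifts. -/
abbrev RadialDom (f : ℂ → ℂ) (d : ℂ) (R : ℝ) : Type :=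
  {q : ℝ × ℂ // q ∈ Ioo 0 R ×ˢ puncPre f d R}

/-- `P ρ z` is the endpoint of the lift, starting at z, of the radial segment from f(z) to distance
ρ from d. Uniqueness of lifts gives the composition law. -/
theorem exists_radial_lift {f : ℂ → ℂ} (hf : Differentiable ℂ f)
    (hna : ∀ a, ¬ IsAsymptoticValue f a) {d : ℂ} {R : ℝ}
    (hreg : ∀ z ∈ puncPre f d R, deriv f z ≠ 0) :
    ∃ P : ℝ → ℂ → ℂ,
      ContinuousOn (fun q : ℝ × ℂ => P q.1 q.2) (Ioo 0 R ×ˢ puncPre f d R) ∧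
      (∀ ρ ∈ Ioo 0 R, ∀ z ∈ puncPre f d R, f (P ρ z) = radialPt d (f z) ρ) ∧
      (∀ z ∈ puncPre f d R, P (dist (f z) d) z = z) ∧
      (∀ ρ ∈ Ioo 0 R, ∀ ρ' ∈ Ioo 0 R, ∀ z ∈ puncPre f d R, P ρ' (P ρ z) = P ρ' z) := by
  classical
  -- the radial path from `f z` to the point at distance `ρ`
  set rad : ℝ × ℂ → ℝ → ℝ := fun q t => (1 - t) * dist (f q.2) d + t * q.1 with hrad
  have hradm : ∀ q ∈ Ioo 0 R ×ˢ puncPre f d R, ∀ t ∈ Icc (0 : ℝ) 1, rad q t ∈ Ioo 0 R := by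
    rintro ⟨ρ, z⟩ ⟨hρ, hz⟩ t ht
    have h1 : dist (f z) d ∈ Ioo 0 R := ⟨dist_pos.2 hz.2, hz.1⟩
    have := (convex_Ioo (0 : ℝ) R) h1 hρ (sub_nonneg.2 ht.2) ht.1 (by ring)
    simpa [hrad] using this
  set β : ℝ × ℂ → ℝ → ℂ := fun q t => radialPt d (f q.2) (rad q t) with hβ
  have hmem : ∀ z ∈ puncPre f d R, ∀ ρ ∈ Ioo 0 R, ∀ w, f w = radialPt d (f z) ρ →
      w ∈ puncPre f d R := fun z hz ρ hρ w hw => by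
    have h1 := dist_radialPt hz.2 hρ.1.le
    rw [← hw] at h1
    exact ⟨by rw [Metric.mem_ball, h1]; exact hρ.2, fun h => by
      rw [h, dist_self] at h1; linarith [hρ.1]⟩
  have hlift : ∀ q : RadialDom f d R, ∃ g, LiftsUpTo f (β q.1) ⟨q.1.2, hreg _ q.2.2⟩ 1 g := by
    rintro ⟨⟨ρ, z⟩, hq⟩
    refine exists_lift hf hna ?_ (fun t ht w hw => hreg w (hmem z hq.2 _ (hradm _ hq t ht) w hw)) _ ?_
    · simp only [hrad, radialPt]; fun_prop
    · simp only [hrad, sub_zero, one_mul, zero_mul, add_zero]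
      exact (radialPt_self hq.2.2).symm
  choose g hg using hlift
  have hfc := hf.continuous
  have hcont : Continuous fun x : unitInterval × RadialDom f d R => g x.2 x.1 := by
    have hβc : Continuous fun x : unitInterval × RadialDom f d R => β x.2.1 x.1 := by
      simp only [hβ, hrad, radialPt]
      have hn : ∀ x : unitInterval × RadialDom f d R, ‖f x.2.1.2 - d‖ ≠ 0 := fun x =>
        norm_ne_zero_iff.2 (sub_ne_zero.2 x.2.2.2.2)
      fun_prop (disch := exact hn)
    -- Homotopy lifting: lifts continuous in time, with continuously varying starting points, are
    -- jointly continuous.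
    refine (isLocalHomeomorph_regMap hf).continuous_lift (T2Space.isSeparatedMap _) ⟨_, hβc⟩
      ?_ ?_ ?_
    · ext ⟨t, q⟩
      exact (hg q).2.1 t t.2
    · have : (fun q : RadialDom f d R => g q ((0 : unitInterval) : ℝ)) = fun q : RadialDom f d R => ⟨q.1.2, hreg _ q.2.2⟩ := by
        ext q
        simp [(hg q).2.2]
      simp only [this]
      fun_prop
    · intro q
      exact (hg q).1.comp_continuous continuous_subtype_val fun t => t.2
  set P : ℝ → ℂ → ℂ := fun ρ z =>
    if h : (ρ, z) ∈ Ioo 0 R ×ˢ puncPre f d R then g ⟨(ρ, z), h⟩ 1 else 0 with hP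
  have hPg : ∀ q : RadialDom f d R, P q.1.1 q.1.2 = g q 1 := fun q => by
    simp only [hP]
    rw [dif_pos q.2]
  have hPc : ContinuousOn (fun q : ℝ × ℂ => P q.1 q.2) (Ioo 0 R ×ˢ puncPre f d R) := by
    rw [continuousOn_iff_continuous_domRestrict]
    have : Continuous fun q : RadialDom f d R => (g q ((1 : unitInterval) : ℝ) : ℂ) :=
      continuous_subtype_val.comp (hcont.comp
        (by fun_prop : Continuous fun q : RadialDom f d R => ((1 : unitInterval), q)))
    refine this.congr fun q => ?_
    exact (hPg q).symm
  have hPf : ∀ ρ ∈ Ioo 0 R, ∀ z ∈ puncPre f d R, f (P ρ z) = radialPt d (f z) ρ := by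
    intro ρ hρ z hz
    have := (hg ⟨(ρ, z), ⟨hρ, hz⟩⟩).2.1 1 (by simp)
    rw [hPg ⟨(ρ, z), ⟨hρ, hz⟩⟩, this]
    simp [hβ, hrad]
  have hPself : ∀ z ∈ puncPre f d R, P (dist (f z) d) z = z := by
    intro z hz
    have hρ : dist (f z) d ∈ Ioo 0 R := ⟨dist_pos.2 hz.2, hz.1⟩
    set q : RadialDom f d R := ⟨(dist (f z) d, z), ⟨hρ, hz⟩⟩ with hq
    rw [hPg q]
    have hconst : LiftsUpTo f (β q.1) ⟨q.1.2, hreg _ q.2.2⟩ 1 fun _ => ⟨q.1.2, hreg _ q.2.2⟩ := by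
      refine ⟨continuousOn_const, fun t _ => ?_, rfl⟩
      have : rad q.1 t = dist (f z) d := by simp only [hrad, hq]; ring
      simp only [hβ, this]
      exact (radialPt_self hz.2).symm
    rw [(hg q).eq hf hconst (right_mem_Icc.2 zero_le_one)]
  have hPm : ∀ ρ ∈ Ioo 0 R, ∀ z ∈ puncPre f d R, P ρ z ∈ puncPre f d R := fun ρ hρ z hz =>
    hmem z hz ρ hρ _ (hPf ρ hρ z hz)
  refine ⟨P, hPc, hPf, hPself, fun ρ hρ ρ' hρ' z hz => ?_⟩
  set w := P ρ z with hw
  have hwm := hPm ρ hρ z hz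
  have hfw : dist (f w) d = ρ := by rw [hPf ρ hρ z hz]; exact dist_radialPt hz.2 hρ.1.le
  have key : ∀ v ∈ puncPre f d R, ∃ γ : ℝ → RegPt f, ContinuousOn γ (Ioo 0 R) ∧
      ∀ s ∈ Ioo 0 R, (γ s : ℂ) = P s v := by
    intro v hv
    refine ⟨fun s => if h : s ∈ Ioo 0 R then ⟨P s v, hreg _ (hPm s h v hv)⟩
      else ⟨v, hreg v hv⟩, ?_, fun s hs => by simp only [hs, dif_pos]⟩
    have hind : Topology.IsInducing (Subtype.val : RegPt f → ℂ) := Topology.IsInducing.subtypeVal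
    refine hind.continuousOn_iff.2 ?_
    have : ContinuousOn (fun s => P s v) (Ioo 0 R) :=
      hPc.comp (f := fun s => (s, v)) (by fun_prop) fun s hs => ⟨hs, hv⟩
    exact this.congr fun s hs => by simp only [Function.comp, hs, dif_pos]
  obtain ⟨γ₁, c₁, e₁⟩ := key w hwm
  obtain ⟨γ₂, c₂, e₂⟩ := key z hz
  -- The curves s ↦ `P s w` and s ↦ `P s z` lie over the same ray and meet at s = ρ.
  have := lift_unique hf isPreconnected_Ioo c₁ c₂ (fun t ht => by
    rw [e₁ t ht, e₂ t ht, hPf t ht w hwm, hPf t ht z hz, hPf ρ hρ z hz,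
      radialPt_radialPt hz.2 hρ.1]) hρ (Subtype.ext (by
      rw [e₁ ρ hρ, e₂ ρ hρ, ← hw]
      conv_lhs => rw [← hfw]
      exact hPself w hwm)) hρ'
  rw [← e₁ ρ' hρ', ← e₂ ρ' hρ', this]

theorem exists_isolating_radius {f : ℂ → ℂ} (hf : Differentiable ℂ f) (y : ℂ) {d : ℂ}
    (hnc : ∃ z, f z ≠ d) : ∃ ε > 0, ∃ m > 0, ∀ z, dist z y = ε → m ≤ dist (f z) d := by
  have ha : AnalyticOnNhd ℂ (fun z => f z - d) univ := fun z _ =>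
    ((hf.sub_const d).analyticAt z)
  have hev : ∀ᶠ z in 𝓝[≠] y, f z - d ≠ 0 := by
    rcases (ha y (mem_univ y)).eventually_eq_zero_or_eventually_ne_zero with h | h
    · obtain ⟨z, hz⟩ := hnc
      exact absurd (ha.eqOn_zero_of_preconnected_of_eventuallyEq_zero isPreconnected_univ
        (mem_univ y) h (mem_univ z)) (sub_ne_zero.2 hz)
    · exact h
  rw [eventually_nhdsWithin_iff] at hev
  obtain ⟨ε, hε, hεs⟩ := Metric.nhds_basis_closedBall.mem_iff.1 hev
  obtain ⟨w, hw, hmin⟩ := (isCompact_sphere y ε).exists_isMinOn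
    (NormedSpace.sphere_nonempty.2 hε.le)
    (hf.continuous.dist (continuous_const (y := d))).continuousOn
  refine ⟨ε, hε, dist (f w) d, dist_pos.2 (sub_ne_zero.1 ?_), fun z hz => hmin hz⟩
  exact hεs (Metric.sphere_subset_closedBall hw) (Metric.ne_of_mem_sphere hw hε.ne')

/-- If there are no asymptotic values, and `d` is the only critical value in a disc around it, then
the preimage of the disc splits into pieces which are compact over smaller closed discs. -/
theorem exists_clopen_piece {f : ℂ → ℂ} (hf : Differentiable ℂ f)
    (hna : ∀ a, ¬ IsAsymptoticValue f a) {d : ℂ} (hnc : ∃ z, f z ≠ d) {R : ℝ} (hR : 0 < R)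
    (hreg : ∀ z ∈ puncPre f d R, deriv f z ≠ 0) {y : ℂ} (hy : f y ∈ Metric.ball d R) :
    ∃ U : Set ℂ, IsOpen U ∧ y ∈ U ∧ U ⊆ f ⁻¹' Metric.ball d R ∧
      IsOpen (f ⁻¹' Metric.ball d R \ U) ∧
      ∀ r < R, IsCompact (U ∩ f ⁻¹' Metric.closedBall d r) := by
  obtain ⟨P, hPc, hPf, hPs, hPP⟩ := exists_radial_lift hf hna hreg
  have hfc := hf.continuous
  have hPd : ∀ ρ ∈ Ioo 0 R, ∀ z ∈ puncPre f d R, dist (f (P ρ z)) d = ρ := fun ρ hρ z hz => by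
    rw [hPf ρ hρ z hz]; exact dist_radialPt hz.2 hρ.1.le
  have hPm : ∀ ρ ∈ Ioo 0 R, ∀ z ∈ puncPre f d R, P ρ z ∈ puncPre f d R := fun ρ hρ z hz =>
    ⟨by rw [Metric.mem_ball, hPd ρ hρ z hz]; exact hρ.2, fun h => by
      have := hPd ρ hρ z hz
      rw [h, dist_self] at this; linarith [hρ.1]⟩
  have hPc1 : ∀ z ∈ puncPre f d R, ContinuousOn (fun s => P s z) (Ioo 0 R) := fun z hz =>
    hPc.comp (f := fun s => (s, z)) (by fun_prop) fun s hs => ⟨hs, hz⟩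
  -- the centre of the piece
  obtain ⟨y₀, hy₀, hyc⟩ : ∃ y₀, f y₀ = d ∧ (f y = d → y = y₀) ∧
      (f y ≠ d → ∀ N ∈ 𝓝 y₀, ∀ η > 0, ∃ ρ ∈ Ioo 0 R, ρ < η ∧ P ρ y ∈ N) := by
    by_cases h : f y = d
    · exact ⟨y, h, fun _ => rfl, fun h' => absurd h h'⟩
    have hym : y ∈ puncPre f d R := ⟨hy, h⟩
    have hmaps : ∀ t ∈ Ico 0 (R / 2), R / 2 - t ∈ Ioo 0 R := fun t ht =>
      ⟨by linarith [ht.2], by linarith [ht.1]⟩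
    have hlim : Tendsto (fun t : ℝ => R / 2 - t) (𝓝[<] (R / 2)) (𝓝 0) := by
      have : Continuous fun t : ℝ => R / 2 - t := by fun_prop
      have h2 := (this.tendsto (R / 2)).mono_left (nhdsWithin_le_nhds (s := Iio (R / 2)))
      simpa using h2
    have hev : ∀ᶠ t in 𝓝[<] (R / 2), t ∈ Ico 0 (R / 2) := Ico_mem_nhdsLT (by linarith)
    obtain ⟨y₀, h0, h1⟩ := exists_clusterPt_of_lift hfc hna (half_pos hR) (b := d)
      (Λ := fun t => P (R / 2 - t) y) ((hPc1 y hym).comp (by fun_prop) hmaps) (by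
        have : Tendsto (fun t : ℝ => radialPt d (f y) (R / 2 - t)) (𝓝[<] (R / 2))
            (𝓝 (radialPt d (f y) 0)) := by
          have hc : Continuous (radialPt d (f y)) := by unfold radialPt; fun_prop
          exact (hc.tendsto 0).comp hlim
        have e : radialPt d (f y) 0 = d := by simp [radialPt]
        rw [e] at this
        refine this.congr' ?_
        filter_upwards [hev] with t ht
        exact (hPf _ (hmaps t ht) y hym).symm)
    refine ⟨y₀, h0, fun h' => absurd h' h, fun _ N hN η hη => ?_⟩
    obtain ⟨t, ht, ht1, ht2⟩ := ((h1.frequently hN).and_eventually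
      ((hlim.eventually_lt_const hη).and hev)).exists
    exact ⟨R / 2 - t, hmaps t ht2, ht1, ht⟩
  obtain ⟨ε, hε, m', hm', hsph'⟩ := exists_isolating_radius hf y₀ hnc
  set m := min m' R with hm
  have hm0 : 0 < m := lt_min hm' hR
  have hmR : m ≤ R := min_le_right _ _
  have hsph : ∀ z, dist (f z) d < m → dist z y₀ ≠ ε := fun z hz h =>
    absurd (hsph' z h) (not_le.2 (hz.trans_le (min_le_left _ _)))
  have hsub : Ioo 0 m ⊆ Ioo 0 R := Ioo_subset_Ioo_right hmR
  -- Over levels below m, a radial lift cannot cross the circle of radius ε around y₀, where |f - d|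
  -- ≥ m.
  have hQ : ∀ z ∈ puncPre f d R, ∀ s ∈ Ioo 0 m, ∀ s' ∈ Ioo 0 m, dist (P s z) y₀ < ε →
      dist (P s' z) y₀ < ε := by
    intro z hz s hs s' hs' h
    by_contra! h'
    obtain ⟨t, ht, hte⟩ := isPreconnected_Ioo.intermediate_value hs hs'
      ((continuous_id.dist (continuous_const (y := y₀))).comp_continuousOn
        ((hPc1 z hz).mono hsub)) ⟨h.le, h'⟩
    exact hsph (P t z) (by rw [hPd t (hsub ht) z hz]; exact ht.2) hte
  set ρ := m / 2 with hρ
  have hρm : ρ ∈ Ioo 0 m := ⟨half_pos hm0, half_lt_self hm0⟩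
  have hρR := hsub hρm
  have hpo : IsOpen (puncPre f d R) :=
    (Metric.isOpen_ball.preimage hfc).inter (isOpen_ne_fun hfc continuous_const)
  have hPρ : ContinuousOn (fun z => dist (P ρ z) y₀) (puncPre f d R) :=
    (continuous_id.dist (continuous_const (y := y₀))).comp_continuousOn
      (hPc.comp (f := fun z => (ρ, z)) (by fun_prop) fun z hz => ⟨hρR, hz⟩)
  -- U collects the points whose inward radial lift ends within ε of y₀, V those for which it ends
  -- farther away. The first set in each union covers the points over d itself, which have no radial
  -- lift.
  set U : Set ℂ := {z | dist (f z) d < m ∧ dist z y₀ < ε} ∪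
    {z | z ∈ puncPre f d R ∧ dist (P ρ z) y₀ < ε} with hU
  set V : Set ℂ := {z | dist (f z) d < m ∧ ε < dist z y₀} ∪
    {z | z ∈ puncPre f d R ∧ ε < dist (P ρ z) y₀} with hV
  have hfd : Continuous fun z => dist (f z) d := hfc.dist continuous_const
  have hzd : Continuous fun z => dist z y₀ := continuous_id.dist continuous_const
  have hUo : IsOpen U := ((isOpen_lt hfd (continuous_const (y := m))).inter
    (isOpen_lt hzd (continuous_const (y := ε)))).union
      (hPρ.isOpen_inter_preimage hpo (isOpen_Iio (a := ε)))
  have hVo : IsOpen V := ((isOpen_lt hfd (continuous_const (y := m))).inter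
    (isOpen_lt (continuous_const (y := ε)) hzd)).union
      (hPρ.isOpen_inter_preimage hpo (isOpen_Ioi (a := ε)))
  have hself : ∀ z ∈ puncPre f d R, dist (f z) d < m → dist (f z) d ∈ Ioo 0 m := fun z hz h =>
    ⟨dist_pos.2 hz.2, h⟩
  have hnear : ∀ z ∈ puncPre f d R, dist (f z) d < m →
      (dist z y₀ < ε ↔ dist (P ρ z) y₀ < ε) := by
    intro z hz h
    constructor
    · intro h'
      refine hQ z hz _ (hself z hz h) ρ hρm ?_
      rwa [hPs z hz]
    · intro h'
      have := hQ z hz ρ hρm _ (hself z hz h) h'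
      rwa [hPs z hz] at this
  have hUV : f ⁻¹' Metric.ball d R \ U = V := by
    ext z
    constructor
    · rintro ⟨hzR, hzU⟩
      rw [hU, mem_union, not_or] at hzU
      by_cases h : f z = d
      · have h1 : dist (f z) d < m := by rw [h, dist_self]; exact hm0
        exact Or.inl ⟨h1, lt_of_le_of_ne (not_lt.1 fun h' => hzU.1 ⟨h1, h'⟩) (hsph z h1).symm⟩
      · have hz : z ∈ puncPre f d R := ⟨hzR, h⟩
        refine Or.inr ⟨hz, lt_of_le_of_ne (not_lt.1 fun h' => hzU.2 ⟨hz, h'⟩) (Ne.symm ?_)⟩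
        exact hsph _ (by rw [hPd ρ hρR z hz]; exact hρm.2)
    · rintro (⟨h1, h2⟩ | ⟨hz, h2⟩)
      · refine ⟨h1.trans_le hmR, ?_⟩
        rintro (⟨-, h3⟩ | ⟨hz, h3⟩)
        · exact lt_asymm h2 h3
        · exact lt_asymm h2 ((hnear z hz h1).2 h3)
      · refine ⟨hz.1, ?_⟩
        rintro (⟨h1, h3⟩ | ⟨-, h3⟩)
        · exact lt_asymm h2 ((hnear z hz h1).1 h3)
        · exact lt_asymm h2 h3
  have hUsub : U ⊆ f ⁻¹' Metric.ball d R := by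
    rintro z (⟨h1, -⟩ | ⟨hz, -⟩)
    · exact h1.trans_le hmR
    · exact hz.1
  refine ⟨U, hUo, ?_, hUsub, hUV ▸ hVo, fun r hr => ?_⟩
  · by_cases h : f y = d
    · refine Or.inl ⟨by rw [h, dist_self]; exact hm0, ?_⟩
      rw [hyc.1 h, dist_self]; exact hε
    · obtain ⟨s, hs, hsm, hsN⟩ := hyc.2 h _ (Metric.ball_mem_nhds y₀ hε) m hm0
      exact Or.inr ⟨⟨hy, h⟩, hQ y ⟨hy, h⟩ s ⟨hs.1, hsm⟩ ρ hρm hsN⟩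
  · have hclosed : IsClosed (U ∩ f ⁻¹' Metric.closedBall d r) := by
      have : U ∩ f ⁻¹' Metric.closedBall d r = f ⁻¹' Metric.closedBall d r \ V := by
        ext z
        constructor
        · rintro ⟨hzU, hz⟩
          exact ⟨hz, fun h => ((hUV.symm ▸ h : z ∈ f ⁻¹' Metric.ball d R \ U)).2 hzU⟩
        · rintro ⟨hz, hzV⟩
          refine ⟨by_contra fun h => hzV ?_, hz⟩
          rw [← hUV]
          exact ⟨lt_of_le_of_lt hz hr, h⟩
      rw [this]
      exact (Metric.isClosed_closedBall.preimage hfc).sdiff hVo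
    -- Over levels below m the piece stays in the closed disc around y₀; from m to r it is swept out
    -- by radial lifts from the compact set C.
    set C : Set ℂ := Metric.closedBall y₀ ε ∩ {z | dist (f z) d = ρ} with hC
    have hCc : IsCompact C := (isCompact_closedBall y₀ ε).inter_right
      (isClosed_eq (by fun_prop) continuous_const)
    have hCp : C ⊆ puncPre f d R := fun z hz => ⟨by
      rw [Metric.mem_ball, hz.2]; exact hρR.2, fun h => by
      have : dist (f z) d = ρ := hz.2
      rw [h, dist_self] at this
      linarith [hρm.1]⟩
    have hK : IsCompact ((fun q : ℝ × ℂ => P q.1 q.2) '' (Icc ρ r ×ˢ C)) :=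
      (isCompact_Icc.prod hCc).image_of_continuousOn (hPc.mono (prod_mono
        (fun s hs => ⟨hρm.1.trans_le hs.1, hs.2.trans_lt hr⟩) hCp))
    refine ((isCompact_closedBall y₀ ε).union hK).of_isClosed_subset hclosed ?_
    rintro z ⟨hzU, hzr⟩
    rcases lt_or_ge (dist (f z) d) m with h | h
    · left
      rcases hzU with ⟨-, h3⟩ | ⟨hz, h3⟩
      · exact h3.le
      · exact ((hnear z hz h).2 h3).le
    · right
      rcases hzU with ⟨h2, -⟩ | ⟨hz, h3⟩
      · exact absurd h2 (not_lt.2 h)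
      · refine ⟨(dist (f z) d, P ρ z), ⟨⟨hρm.2.le.trans h, hzr⟩, Metric.mem_closedBall.2 h3.le,
          hPd ρ hρR z hz⟩, ?_⟩
        simp only
        rw [hPP ρ hρR _ ⟨dist_pos.2 hz.2, hz.1⟩ z hz, hPs z hz]

/-! ### Pulled-back Cauchy kernels: the case of no preimage in X. -/

/-- In fact ∂̄(χ ∘ f) is the conjugate of f' times (∂̄χ) ∘ f. -/
theorem norm_dbar_comp_holomorphic {χ f : ℂ → ℂ} {z : ℂ} (hχ : DifferentiableAt ℝ χ (f z))
    (hf : DifferentiableAt ℂ f z) :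
    ‖dbar (fun w => χ (f w)) z‖ = ‖deriv f z‖ * ‖dbar χ (f z)‖ := by
  have h1 := hf.hasDerivAt.hasFDerivAt.restrictScalars ℝ
  have h2 := hχ.hasFDerivAt.comp z h1
  have e : fderiv ℝ (fun w => χ (f w)) z = _ := h2.fderiv
  have ev : ∀ v, fderiv ℝ (fun w => χ (f w)) z v = fderiv ℝ χ (f z) (deriv f z * v) := fun v => by
    rw [e]; simp [mul_comm]
  rw [← norm_conj (deriv f z), ← norm_mul]
  congr 1
  have hp : (starRingEnd ℂ) (deriv f z) = (deriv f z).re - (deriv f z).im * I :=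
    Complex.ext (by simp) (by simp)
  simp only [dbar, ev]
  rw [mul_one, fderiv_real_apply _ (deriv f z), fderiv_real_apply _ (deriv f z * I), hp]
  simp only [mul_re, mul_im, I_re, I_im, mul_zero, mul_one, zero_sub, ofReal_neg, add_zero]
  linear_combination ((deriv f z).im * fderiv ℝ χ (f z) I / 2) * I_mul_I

theorem norm_pairing_le {f : ℂ → ℂ} {c : ℂ} (hs : IsSummablePoint f c) {X : Set ℂ}
    (hφ : ∀ z ∉ X, z ≠ 0 → z ≠ 1 → ruelleA f (f c) z = 0) {h : ℂ → ℂ} (hh : ContDiff ℝ 1 h)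
    (hc : HasCompactSupport h) (h0 : h 0 = 0) (h1 : h 1 = 0) {B : ℝ}
    (hB : ∀ z ∈ X, ‖dbar h z‖ ≤ B) :
    ‖∑' n, 1 / deriv (f^[n]) (f c) * h (f^[n] (f c))‖ ≤
      (∫ z, ‖ruelleA f (f c) z‖) * B / Real.pi := by
  obtain ⟨hi, hp⟩ := ruelleA_pairing hs
  have e := hp h hh hc h0 h1
  rw [le_div_iff₀ Real.pi_pos]
  have e2 : ‖∑' n, 1 / deriv (f^[n]) (f c) * h (f^[n] (f c))‖ * Real.pi =
      ‖∫ z, ruelleA f (f c) z * dbar h z‖ := by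
    rw [e, norm_mul, norm_neg, norm_real, Real.norm_eq_abs, abs_of_pos Real.pi_pos, mul_comm]
  rw [e2, ← integral_mul_const]
  refine norm_integral_le_of_norm_le (hi.norm.mul_const _) ?_
  have hne : ∀ p : ℂ, ∀ᵐ z : ℂ, z ≠ p := fun p => by simp [ae_iff]
  filter_upwards [hne 0, hne 1] with z z0 z1
  rw [norm_mul]
  by_cases hz : z ∈ X
  · gcongr
    exact hB z hz
  · simp [hφ z hz z0 z1]

/-- The Cauchy kernel at `w`, cut off by `χ`, pulled back as a vector field by `f`, and restricted
to `U`. -/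
noncomputable def pullKernel (f χ : ℂ → ℂ) (w : ℂ) (U : Set ℂ) : ℂ → ℂ := by
  classical
  exact fun z => if z ∈ U then χ (f z) * ((f z - w) * deriv f z)⁻¹ else 0

/-- The factor |f'| from ∂̄(χ ∘ f) cancels the 1/|f'| of the vector field, so the bound is that of
the kernel itself, independent of w and U. -/
theorem norm_pairing_pullKernel_le {f : ℂ → ℂ} {c : ℂ} (hf : Differentiable ℂ f)
    (hs : IsSummablePoint f c) {X : Set ℂ} (hX : IsClosed X) (hfX : ∀ z ∈ X, f z ∈ X)
    (haX : ∀ n, f^[n] (f c) ∈ X)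
    (hφ : ∀ z ∉ X, z ≠ 0 → z ≠ 1 → ruelleA f (f c) z = 0) (hpre : ∀ z ∈ X, f z ≠ f c)
    (f0 : f 0 = 0) (f1 : f 1 = 1) {χ : ℂ → ℂ} (hχ : ContDiff ℝ 1 χ) {r s R : ℝ} (hr : 0 < r)
    (hsR : s < R) (χ1 : ∀ z ∈ Metric.closedBall (f c) r, χ z = 1)
    (χt : tsupport χ = Metric.closedBall (f c) s) (χ00 : χ 0 = 0) (χ01 : χ 1 = 0) {M : ℝ}
    (hM : ∀ z, ‖dbar χ z‖ ≤ M) (hreg : ∀ z ∈ puncPre f (f c) R, deriv f z ≠ 0) {w : ℂ}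
    (hwX : w ∉ X) (hw : dist w (f c) < r / 2) {U : Set ℂ} (hU : IsOpen U)
    (hUs : U ⊆ f ⁻¹' Metric.ball (f c) R) (hUc : IsOpen (f ⁻¹' Metric.ball (f c) R \ U))
    (hUK : IsCompact (U ∩ f ⁻¹' Metric.closedBall (f c) s)) :
    ‖∑' n, 1 / deriv (f^[n]) (f c) * pullKernel f χ w U (f^[n] (f c))‖ ≤
      (∫ z, ‖ruelleA f (f c) z‖) * (M * (2 / r)) / Real.pi := by
  classical
  have hfc := hf.continuous
  have hM0 : 0 ≤ M := (norm_nonneg _).trans (hM 0)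
  have hf' : Differentiable ℂ (deriv f) := fun z =>
    (hf.analyticAt z).deriv.differentiableAt
  -- Z contains all singularities of the pull-back, since critical points in U lie over the critical
  -- value only. It misses X by invariance and by `hpre`, so the kernel can be smoothed near Z
  -- without changing it near X.
  set Z : Set ℂ := f ⁻¹' {w} ∪ f ⁻¹' {f c} with hZ
  have hZc : IsClosed Z := (isClosed_singleton.preimage hfc).union (isClosed_singleton.preimage hfc)
  have hZX : Disjoint Z X := by
    rw [Set.disjoint_left]
    rintro z (hz | hz) hzX
    · exact hwX (by rw [← show f z = w from hz]; exact hfX z hzX)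
    · exact hpre z hzX hz
  have hχ0 : ∀ z ∉ Metric.closedBall (f c) s, χ z = 0 := fun z hz =>
    image_eq_zero_of_notMem_tsupport (by rwa [χt])
  have hin : ∀ z ∈ U, pullKernel f χ w U =ᶠ[𝓝 z]
      fun z => χ (f z) * ((f z - w) * deriv f z)⁻¹ := fun z hz => by
    filter_upwards [hU.mem_nhds hz] with u hu
    simp [pullKernel, hu]
  have hout : ∀ z ∉ U, pullKernel f χ w U =ᶠ[𝓝 z] fun _ => 0 := fun z hz => by
    by_cases hzR : z ∈ f ⁻¹' Metric.ball (f c) R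
    · filter_upwards [hUc.mem_nhds ⟨hzR, hz⟩] with u hu
      simp [pullKernel, hu.2]
    · have hzs : z ∈ (f ⁻¹' Metric.closedBall (f c) s)ᶜ := fun h =>
        hzR (Metric.closedBall_subset_ball hsR h)
      filter_upwards [(Metric.isClosed_closedBall.preimage hfc).isOpen_compl.mem_nhds hzs]
        with u hu
      simp [pullKernel, hχ0 (f u) hu]
  have hJ : ∀ z ∈ U, z ∉ Z → DifferentiableAt ℂ (fun z => ((f z - w) * deriv f z)⁻¹) z ∧
      (f z - w) * deriv f z ≠ 0 := fun z hz hzZ => by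
    have h1 : f z ≠ w := fun h => hzZ (Or.inl h)
    have h2 : f z ≠ f c := fun h => hzZ (Or.inr h)
    have h3 := mul_ne_zero (sub_ne_zero.2 h1) (hreg z ⟨hUs hz, h2⟩)
    exact ⟨(((hf z).sub_const w).mul (hf' z)).inv h3, h3⟩
  have hsm : ∀ z ∉ Z, ContDiffAt ℝ 1 (pullKernel f χ w U) z := by
    intro z hz
    by_cases hzU : z ∈ U
    · refine ContDiffAt.congr_of_eventuallyEq ?_ (hin z hzU)
      have c1 : ContDiff ℝ 1 f := (hf.contDiff (n := 1)).restrict_scalars ℝ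
      have c2 : ContDiff ℝ 1 (deriv f) := (hf'.contDiff (n := 1)).restrict_scalars ℝ
      exact (hχ.comp c1).contDiffAt.mul
        (((c1.sub contDiff_const).mul c2).contDiffAt.inv (hJ z hzU hz).2)
    · exact contDiffAt_const.congr_of_eventuallyEq (hout z hzU)
  obtain ⟨h, hh, hhX, hh0⟩ := exists_smooth_modification hZc hX hZX hsm
  have hval : ∀ n, h (f^[n] (f c)) = pullKernel f χ w U (f^[n] (f c)) := fun n =>
    (hhX _ (haX n)).self_of_nhds
  simp_rw [← hval]
  refine norm_pairing_le hs hφ hh (HasCompactSupport.intro hUK fun z hz => hh0 z ?_)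
    (hh0 _ ?_) (hh0 _ ?_) fun z hz => ?_
  · by_cases hzU : z ∈ U
    · simp [pullKernel, hχ0 (f z) fun h' => hz ⟨hzU, h'⟩]
    · simp [pullKernel, hzU]
  · simp [pullKernel, f0, χ00]
  · simp [pullKernel, f1, χ01]
  · rw [dbar_congr (hhX z hz)]
    by_cases hzU : z ∈ U
    · have hzZ : z ∉ Z := fun h' => Set.disjoint_left.1 hZX h' hz
      obtain ⟨j1, j2⟩ := hJ z hzU hzZ
      have hχf : DifferentiableAt ℝ (fun z => χ (f z)) z :=
        (hχ.differentiable one_ne_zero _).comp z ((hf z).restrictScalars ℝ)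
      rw [dbar_congr (hin z hzU), dbar_mul_holomorphic hχf j1, norm_mul,
        norm_dbar_comp_holomorphic (hχ.differentiable one_ne_zero _) (hf z), norm_inv, norm_mul]
      have p1 := norm_pos_iff.2 (left_ne_zero_of_mul j2)
      have p2 := norm_pos_iff.2 (right_ne_zero_of_mul j2)
      have e : (‖f z - w‖ * ‖deriv f z‖)⁻¹ * (‖deriv f z‖ * ‖dbar χ (f z)‖) =
          ‖dbar χ (f z)‖ * ‖f z - w‖⁻¹ := by field_simp
      rw [e]
      by_cases hzr : f z ∈ Metric.ball (f c) r
      · have : dbar χ (f z) = 0 := by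
          rw [dbar_congr (h := fun _ => 1), dbar_const]
          filter_upwards [Metric.isOpen_ball.mem_nhds hzr] with u hu
          exact χ1 u (Metric.ball_subset_closedBall hu)
        rw [this, norm_zero, zero_mul]
        positivity
      · have h3 : r ≤ dist (f z) (f c) := not_lt.1 hzr
        have h4 := dist_triangle (f z) w (f c)
        have h5 : r / 2 ≤ ‖f z - w‖ := by rw [← dist_eq_norm]; linarith
        have h6 : ‖f z - w‖⁻¹ ≤ 2 / r := by
          rw [← inv_div]; exact inv_anti₀ (by positivity) h5
        gcongr
        exact hM _
    · rw [dbar_congr (hout z hzU), dbar_const, norm_zero]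
      positivity

theorem norm_dbar_kernel_le {χ : ℂ → ℂ} (hχ : ContDiff ℝ 1 χ) {d w z : ℂ} {r M : ℝ} (hr : 0 < r)
    (χ1 : ∀ z ∈ Metric.closedBall d r, χ z = 1) (hM : ∀ z, ‖dbar χ z‖ ≤ M)
    (hw : dist w d < r / 2) (hz : z ≠ w) :
    ‖dbar (fun u => χ u * (u - w)⁻¹) z‖ ≤ M * (2 / r) := by
  have hM0 : 0 ≤ M := (norm_nonneg _).trans (hM 0)
  have hJ : DifferentiableAt ℂ (fun u => (u - w)⁻¹) z :=
    (differentiableAt_id.sub_const w).inv (sub_ne_zero.2 hz)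
  rw [dbar_mul_holomorphic (hχ.differentiable one_ne_zero _) hJ, norm_mul, norm_inv, mul_comm]
  by_cases hzr : z ∈ Metric.ball d r
  · have : dbar χ z = 0 := by
      rw [dbar_congr (h := fun _ => 1), dbar_const]
      filter_upwards [Metric.isOpen_ball.mem_nhds hzr] with u hu
      exact χ1 u (Metric.ball_subset_closedBall hu)
    rw [this, norm_zero, zero_mul]
    positivity
  · have h3 : r ≤ dist z d := not_lt.1 hzr
    have h4 := dist_triangle z w d
    have h5 : r / 2 ≤ ‖z - w‖ := by rw [← dist_eq_norm]; linarith
    have h6 : ‖z - w‖⁻¹ ≤ 2 / r := by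
      rw [← inv_div]; exact inv_anti₀ (by positivity) h5
    gcongr
    exact hM _

theorem exists_crit_isolating_radius {f : ℂ → ℂ} (hfin : (f '' critPts f).Finite) (d : ℂ)
    (hd0 : d ≠ 0) (hd1 : d ≠ 1) :
    ∃ R > 0, 0 ∉ Metric.closedBall d R ∧ 1 ∉ Metric.closedBall d R ∧
      ∀ z ∈ puncPre f d R, deriv f z ≠ 0 := by
  obtain ⟨ρ, hρ, h0, h1⟩ := exists_radius_avoiding hd0 hd1
  have hcl : ((f '' critPts f) \ {d})ᶜ ∈ 𝓝 d :=
    (hfin.subset sdiff_subset).isClosed.isOpen_compl.mem_nhds (by simp)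
  obtain ⟨R, hR, hRs⟩ := Metric.mem_nhds_iff.1 hcl
  have hsub : Metric.closedBall d (min ρ R) ⊆ Metric.closedBall d ρ :=
    Metric.closedBall_subset_closedBall (min_le_left _ _)
  refine ⟨min ρ R, lt_min hρ hR, fun h => h0 (hsub h), fun h => h1 (hsub h), fun z hz hz' => ?_⟩
  exact hRs (Metric.ball_subset_ball (min_le_right _ _) hz.1) ⟨⟨z, hz', rfl⟩, hz.2⟩

/-- If no preimage of the critical value lies in the closure of its orbit, then `ruelleA` does not
vanish on the complement. -/
theorem false_of_preimage_disjoint {f : ℂ → ℂ} {c : ℂ} (hf : Differentiable ℂ f)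
    (hs : IsSummablePoint f c) (hna : ∀ a, ¬ IsAsymptoticValue f a)
    (hfin : (f '' critPts f).Finite) (hnc : ∃ z, f z ≠ f c) (f0 : f 0 = 0) (f1 : f 1 = 1)
    (hd0 : f c ≠ 0) (hd1 : f c ≠ 1) {X : Set ℂ} (hX : IsClosed X) (hfX : ∀ z ∈ X, f z ∈ X)
    (hdX : f c ∈ X) (hint : f c ∉ interior X) (hpre : ∀ z ∈ X, f z ≠ f c)
    (hφ : ∀ z ∉ X, z ≠ 0 → z ≠ 1 → ruelleA f (f c) z = 0) : False := by
  classical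
  set d := f c with hd
  set a : ℕ → ℂ := fun n => f^[n] d with ha
  set l : ℕ → ℂ := fun n => 1 / deriv (f^[n]) d with hl
  have haX : ∀ n, a n ∈ X := fun n => by
    induction n with
    | zero => exact hdX
    | succ n ih => rw [ha]; simp only [Function.iterate_succ_apply']; exact hfX _ ih
  have hls : Summable fun n => ‖l n‖ := by simpa [hl] using hs.summable_inv
  obtain ⟨R, hR, hR0, hR1, hreg⟩ := exists_crit_isolating_radius hfin d hd0 hd1
  have hr : 0 < R / 4 := by positivity
  have hrs : R / 4 < R / 2 := by linarith
  have hsR : R / 2 < R := by linarith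
  obtain ⟨χ, χs, -, χ1, χ0, χt⟩ := exists_cutoff d hr hrs
  have χc : HasCompactSupport χ := by rw [HasCompactSupport, χt]; exact isCompact_closedBall _ _
  obtain ⟨M, hM0, hM⟩ := exists_dbar_bound χs χc
  have hballs : Metric.ball d (R / 2) ⊆ Metric.closedBall d R :=
    Metric.ball_subset_closedBall.trans (Metric.closedBall_subset_closedBall hsR.le)
  have χ00 : χ 0 = 0 := χ0 0 fun h => hR0 (hballs h)
  have χ01 : χ 1 = 0 := χ0 1 fun h => hR1 (hballs h)
  set K : ℝ := (∫ z, ‖ruelleA f d z‖) * (M * (2 / (R / 4))) / Real.pi with hK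
  have hK0 : 0 ≤ K := by
    have : 0 ≤ ∫ z, ‖ruelleA f d z‖ := integral_nonneg fun z => norm_nonneg _
    have := Real.pi_pos
    positivity
  -- 1/(d - w) is the difference of two sums, over the kernel and over its pull-back, each at most
  -- K.
  have key : ∀ w ∉ X, dist w d < R / 4 / 2 → ‖d - w‖⁻¹ ≤ 2 * K := by
    intro w hwX hw
    set G : ℂ → ℂ := fun u => χ u * (u - w)⁻¹ with hG
    have hwd : ∀ z ∈ X, z ≠ w := fun z hz h => hwX (h ▸ hz)
    obtain ⟨h, hh, hhX, hh0⟩ := exists_smooth_modification (s := {w}) isClosed_singleton hX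
      (Set.disjoint_singleton_left.2 hwX) (g := G) fun z hz =>
        χs.contDiffAt.mul ((contDiffAt_id.sub contDiffAt_const).inv (sub_ne_zero.2 hz))
    have hval : ∀ n, h (a n) = G (a n) := fun n => (hhX _ (haX n)).self_of_nhds
    have hhc : HasCompactSupport h := χc.mono fun z hz hz' => hz (hh0 z (by simp [hG, hz']))
    have b1 : ‖∑' n, l n * G (a n)‖ ≤ K := by
      simp_rw [← hval]
      refine norm_pairing_le hs hφ hh hhc (hh0 _ (by simp [hG, χ00])) (hh0 _ (by simp [hG, χ01]))
        fun z hz => ?_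
      rw [dbar_congr (hhX z hz)]
      exact norm_dbar_kernel_le χs hr χ1 hM hw (hwd z hz)
    obtain ⟨B, hB⟩ := hh.continuous.bounded_above_of_compact_support hhc
    have hGB : ∀ n, ‖G (a n)‖ ≤ B := fun n => by rw [← hval]; exact hB _
    have hB0 : 0 ≤ B := (norm_nonneg _).trans (hB 0)
    have hsG : Summable fun n => l n * G (a n) :=
      Summable.of_norm_bounded (hls.mul_right B) fun n => by
        rw [norm_mul]; gcongr; exact hGB n
    have hlsucc : ∀ n, l (n + 1) * G (a (n + 1)) =
        l n * (χ (f (a n)) * ((f (a n) - w) * deriv f (a n))⁻¹) := fun n => by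
      simp only [hl, hG, ha, Function.iterate_succ_apply']
      rw [add_comm n 1, iterate_add_deriv hf, Function.iterate_one, one_div, one_div, mul_inv,
        mul_inv]
      ring
    -- finite unions of pieces of the preimage of the disc
    have hpiece : ∀ y, ∃ U : Set ℂ, IsOpen U ∧ (y ∈ f ⁻¹' Metric.ball d R → y ∈ U) ∧
        U ⊆ f ⁻¹' Metric.ball d R ∧ IsOpen (f ⁻¹' Metric.ball d R \ U) ∧
        IsCompact (U ∩ f ⁻¹' Metric.closedBall d (R / 2)) := fun y => by
      by_cases hy : y ∈ f ⁻¹' Metric.ball d R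
      · obtain ⟨U, u1, u2, u3, u4, u5⟩ := exists_clopen_piece hf hna hnc hR hreg hy
        exact ⟨U, u1, fun _ => u2, u3, u4, u5 _ hsR⟩
      · exact ⟨∅, isOpen_empty, fun h' => absurd h' hy, empty_subset _,
          by simpa using Metric.isOpen_ball.preimage hf.continuous, by simp⟩
    choose U u1 u2 u3 u4 u5 using fun n => hpiece (a n)
    set W : ℕ → Set ℂ := fun N => ⋃ n ∈ Finset.range N, U n with hW
    have w1 : ∀ N, IsOpen (W N) := fun N => isOpen_biUnion fun n _ => u1 n
    have w3 : ∀ N, W N ⊆ f ⁻¹' Metric.ball d R := fun N => iUnion₂_subset fun n _ => u3 n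
    have w4 : ∀ N, IsOpen (f ⁻¹' Metric.ball d R \ W N) := fun N => by
      induction N with
      | zero => simpa [hW] using Metric.isOpen_ball.preimage hf.continuous
      | succ N ih =>
        have : f ⁻¹' Metric.ball d R \ W (N + 1) =
            (f ⁻¹' Metric.ball d R \ W N) ∩ (f ⁻¹' Metric.ball d R \ U N) := by
          simp only [hW, Finset.range_add_one, Finset.set_biUnion_insert]
          ext z
          simp only [Set.mem_sdiff, mem_union, mem_inter_iff]
          tauto
        rw [this]
        exact ih.inter (u4 N)
    have w5 : ∀ N, IsCompact (W N ∩ f ⁻¹' Metric.closedBall d (R / 2)) := fun N => by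
      simp only [hW, iUnion₂_inter]
      exact (Finset.range N).isCompact_biUnion fun n _ => u5 n
    have b2 : ∀ N, ‖∑' n, l n * pullKernel f χ w (W N) (a n)‖ ≤ K := fun N =>
      norm_pairing_pullKernel_le hf hs hX hfX haX hφ hpre f0 f1 χs hr hsR χ1 χt χ00 χ01 hM hreg hwX
        hw (w1 N) (w3 N) (w4 N) (w5 N)
    have hpk : ∀ N n, l n * pullKernel f χ w (W N) (a n) =
        if a n ∈ W N then l (n + 1) * G (a (n + 1)) else 0 := fun N n => by
      rw [hlsucc]
      simp only [pullKernel]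
      split_ifs <;> simp
    -- Each orbit point over the disc eventually lies in W N, and the remaining ones contribute 0
    -- because χ vanishes at their images.
    have hlim : Tendsto (fun N => ∑' n, l n * pullKernel f χ w (W N) (a n)) atTop
        (𝓝 (∑' n, l (n + 1) * G (a (n + 1)))) := by
      refine tendsto_tsum_of_dominated_convergence
        (((summable_nat_add_iff 1).2 hls).mul_right B) (fun n => ?_)
        (Eventually.of_forall fun N n => ?_)
      · refine tendsto_const_nhds.congr' ?_
        filter_upwards [eventually_gt_atTop n] with N hN
        rw [hpk]
        by_cases hn : a n ∈ f ⁻¹' Metric.ball d R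
        · rw [if_pos (mem_iUnion₂.2 ⟨n, Finset.mem_range.2 hN, u2 n hn⟩)]
        · have : G (a (n + 1)) = 0 := by
            have : χ (a (n + 1)) = 0 := χ0 _ fun h' => hn (by
              simp only [ha, Function.iterate_succ_apply'] at h'
              exact Metric.ball_subset_ball hsR.le h')
            simp [hG, this]
          simp [this]
      · rw [hpk]
        split_ifs
        · rw [norm_mul]; gcongr; exact hGB _
        · rw [norm_zero]; positivity
    have b3 : ‖∑' n, l (n + 1) * G (a (n + 1))‖ ≤ K := le_of_tendsto' hlim.norm b2
    have hsplit := hsG.tsum_eq_zero_add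
    have e0 : l 0 * G (a 0) = (d - w)⁻¹ := by
      simp [hl, hG, ha, χ1 d (Metric.mem_closedBall_self hr.le)]
    rw [e0] at hsplit
    have : (d - w)⁻¹ = ∑' n, l n * G (a n) - ∑' n, l (n + 1) * G (a (n + 1)) := by
      rw [hsplit]; ring
    rw [← norm_inv, this]
    linarith [norm_sub_le (∑' n, l n * G (a n)) (∑' n, l (n + 1) * G (a (n + 1)))]
  have hcl : d ∈ closure Xᶜ := by rw [closure_compl]; exact hint
  obtain ⟨w, hwX, hw⟩ := Metric.mem_closure_iff.1 hcl (min (R / 4 / 2) (2 * K + 1)⁻¹) (by positivity)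
  have hne : d - w ≠ 0 := sub_ne_zero.2 fun h => hwX (h ▸ hdX)
  have h1 := key w hwX (by rw [dist_comm]; exact hw.trans_le (min_le_left _ _))
  have h2 := hw.trans_le (min_le_right _ _)
  rw [dist_eq_norm] at h2
  have h3 := (lt_inv_comm₀ (norm_pos_iff.2 hne) (by positivity)).1 h2
  linarith

/-! ### Zero sets of definite size near the critical value, and the conclusion. -/

theorem isOpen_fatouSet (f : ℂ → ℂ) : IsOpen (fatouSet f) := by
  refine isOpen_iff_mem_nhds.2 fun z ⟨U, hU, hz, hn⟩ => ?_
  filter_upwards [hU.mem_nhds hz] with w hw using ⟨U, hU, hw, hn⟩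

theorem IsComponentOf.isOpen {D S : Set ℂ} (h : IsComponentOf D S) (hS : IsOpen S) :
    IsOpen D := by
  obtain ⟨z, -, rfl⟩ := h
  exact hS.connectedComponentIn

theorem IsComponentOf.disjoint_frontier {D S : Set ℂ} (h : IsComponentOf D S) (hS : IsOpen S) :
    Disjoint (frontier D) S := by
  refine disjoint_left.2 fun w hw hwS => ?_
  have hD := h.isOpen hS
  obtain ⟨z, hz, rfl⟩ := h
  rw [hD.frontier_eq] at hw
  obtain ⟨u, hu, hu'⟩ := mem_closure_iff.1 hw.1 _ hS.connectedComponentIn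
    (mem_connectedComponentIn hwS)
  refine hw.2 ?_
  rw [connectedComponentIn_eq hu', ← connectedComponentIn_eq hu]
  exact mem_connectedComponentIn hwS

/-- Y accumulates at the critical value. A component meeting the disc of radius ε but contained in
that of radius 2ε would have diameter at most 4ε < δ. -/
theorem false_of_large_components {f : ℂ → ℂ} {c : ℂ} (hf : Differentiable ℂ f)
    (hs : IsSummablePoint f c) (hd0 : f c ≠ 0) (hd1 : f c ≠ 1)
    (hint : f c ∉ interior (orbitClosure f (f c)))
    (hY : ComponentsDiamBoundedBelow (orbitClosure f (f c))ᶜ)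
    (hφ : ∀ z ∉ orbitClosure f (f c), z ≠ 0 → z ≠ 1 → ruelleA f (f c) z = 0) : False := by
  obtain ⟨δ, hδ, hD⟩ := hY
  refine false_of_long_zero_sets hf hs hd0 hd1 (δ := δ / 4) (by positivity) fun ε hε hεδ => ?_
  rw [← mem_compl_iff, ← closure_compl] at hint
  obtain ⟨p, hp, hpd⟩ := Metric.mem_closure_iff.1 hint ε hε
  have hsub := connectedComponentIn_subset (orbitClosure f (f c))ᶜ p
  refine ⟨connectedComponentIn (orbitClosure f (f c))ᶜ p,
    isClosed_closure.isOpen_compl.connectedComponentIn, isPreconnected_connectedComponentIn,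
    fun n hn => hsub hn (subset_closure ⟨n, rfl⟩), fun z hz => hφ z (hsub hz),
    ⟨p, mem_connectedComponentIn hp, by rwa [dist_comm]⟩, ?_⟩
  by_contra! hq
  have h1 := hD _ ⟨p, hp, rfl⟩
  have h2 : Metric.ediam (connectedComponentIn (orbitClosure f (f c))ᶜ p) ≤
      ENNReal.ofReal (4 * ε) := by
    refine Metric.ediam_le fun x hx y hy => ?_
    rw [edist_dist]
    refine ENNReal.ofReal_le_ofReal ?_
    have := dist_triangle_right x y (f c)
    linarith [hq x hx, hq y hy]
  have := (ENNReal.ofReal_le_ofReal_iff (by positivity)).1 (h1.trans h2)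
  linarith

/-- The critical value lies on the boundary of some Fatou component D. Boundaries of Fatou
components miss the Fatou set, so D misses X, and this single D serves at every scale. -/
theorem false_of_subset_iUnion_frontier {f : ℂ → ℂ} {c : ℂ} (hf : Differentiable ℂ f)
    (hs : IsSummablePoint f c) (hd0 : f c ≠ 0) (hd1 : f c ≠ 1)
    (hX : orbitClosure f (f c) ⊆
      ⋃ (D : Set ℂ) (_ : IsComponentOf D (fatouSet f)), frontier D)
    (hφ : ∀ z ∉ orbitClosure f (f c), z ≠ 0 → z ≠ 1 → ruelleA f (f c) z = 0) : False := by
  obtain ⟨D, hD, hdD⟩ := mem_iUnion₂.1 (hX (subset_closure ⟨0, rfl⟩))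
  simp only [Function.iterate_zero, id] at hdD
  have hDF : D ⊆ fatouSet f := by
    obtain ⟨z, -, rfl⟩ := hD
    exact connectedComponentIn_subset _ _
  have hDX : ∀ z ∈ D, z ∉ orbitClosure f (f c) := fun z hz hzX => by
    obtain ⟨D', hD', hz'⟩ := mem_iUnion₂.1 (hX hzX)
    exact disjoint_left.1 (hD'.disjoint_frontier (isOpen_fatouSet f)) hz' (hDF hz)
  have hDo := hD.isOpen (isOpen_fatouSet f)
  have hDc : IsPreconnected D := by
    obtain ⟨z, -, rfl⟩ := hD
    exact isPreconnected_connectedComponentIn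
  rw [hDo.frontier_eq] at hdD
  obtain ⟨q, hq, -⟩ := Metric.mem_closure_iff.1 hdD.1 1 one_pos
  have hqd : 0 < dist q (f c) := dist_pos.2 fun h => hdD.2 (h ▸ hq)
  refine false_of_long_zero_sets hf hs hd0 hd1 (half_pos hqd) fun ε hε hεδ => ?_
  obtain ⟨p, hp, hpd⟩ := Metric.mem_closure_iff.1 hdD.1 ε hε
  exact ⟨D, hDo, hDc, fun n hn => hDX _ hn (subset_closure ⟨n, rfl⟩), fun z hz => hφ z (hDX z hz),
    ⟨p, hp, by rwa [dist_comm]⟩, q, hq, by linarith⟩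

end RuelleEntire

end

theorem proposition6p6 (f : ℂ → ℂ) (c₁ d₁ : ℂ) (hf : RuelleEntire.HasSummableCritPt f c₁)
    (hd : d₁ = f c₁) (hd0 : d₁ ≠ 0) (hd1 : d₁ ≠ 1)
    (Y : Set ℂ) (hY : Y = (RuelleEntire.orbitClosure f d₁)ᶜ)
    (hcase :
      (f ⁻¹' {d₁} ∩ RuelleEntire.XSet f c₁ = ∅) ∨
      (Y.Nonempty ∧ RuelleEntire.ComponentsDiamBoundedBelow Y) ∨
      (MeasureTheory.volume (RuelleEntire.XSet f c₁) = 0) ∨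
      (RuelleEntire.XSet f c₁ ⊆
        ⋃ (D : Set ℂ) (_ : RuelleEntire.IsComponentOf D (RuelleEntire.fatouSet f)), frontier D)) :
    ∃ z ∈ Y, z ≠ 0 ∧ z ≠ 1 ∧ RuelleEntire.ruelleA f d₁ z ≠ 0 := by
  subst hd hY
  have hdf := hf.admissible.transcendental.1
  have hs := hf.summable
  by_contra! hφ
  rcases hcase with h | ⟨hne, h⟩ | h | h
  · have hpre : ∀ z ∈ RuelleEntire.orbitClosure f (f c₁), f z ≠ f c₁ := fun z hz hz' =>
      (h.subset ⟨hz', hz⟩ : z ∈ (∅ : Set ℂ))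
    -- As a preimage of its own critical value, c₁ lies outside X here, so Y is nonempty.
    refine RuelleEntire.false_of_preimage_disjoint hdf hs hf.admissible.no_asymptoticValue
      hf.admissible.finite_critVals ⟨0, by rw [hf.map_zero]; exact hd0.symm⟩ hf.map_zero hf.map_one
      hd0 hd1 (X := RuelleEntire.orbitClosure f (f c₁)) isClosed_closure (fun z hz => ?_)
      (subset_closure ⟨0, rfl⟩)
      (RuelleEntire.notMem_interior_orbitClosure hdf hf.mem_julia
        ⟨c₁, fun h' => hpre c₁ h' rfl⟩) hpre hφ
    refine map_mem_closure hdf.continuous hz ?_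
    rintro _ ⟨n, rfl⟩
    exact ⟨n + 1, Function.iterate_succ_apply' f n _⟩
  · exact RuelleEntire.false_of_large_components hdf hs hd0 hd1
      (RuelleEntire.notMem_interior_orbitClosure hdf hf.mem_julia hne) h hφ
  · refine RuelleEntire.not_ae_zero hdf hs hd0 hd1 ?_
    filter_upwards [MeasureTheory.compl_mem_ae_iff.2 h,
      MeasureTheory.compl_mem_ae_iff.2 (MeasureTheory.measure_singleton (0 : ℂ)),
      MeasureTheory.compl_mem_ae_iff.2 (MeasureTheory.measure_singleton (1 : ℂ))] with z hz hz0 hz1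
    exact hφ z hz hz0 hz1
  · exact RuelleEntire.false_of_subset_iUnion_frontier hdf hs hd0 hd1 h hφ
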